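/- **Theorem 2.8.** Let $T$ be a finite tree with $n$ vertices and let $D=(d_0\ge d_1\ge\dots\ge d_{n-1})$ be its degree sequence. The *greedy tree* $G(D)$ has vertices $0,1,\dots,n-1$, labelled in the order in which the following algorithm creates them: vertex $0$ is the root, and its neighbours are $1,\dots,d_0$; then the vertices $1,2,3,\dots$ take turns in this order, and vertex $i\ge 1$ is joined to the next $d_i-1$ labels that have not been used yet. (Thus vertex $i$ receives the degree $d_i$: newly labelled vertices always get the largest available degrees.) A *rooted spanning forest* of a graph $G$ is a pair $(F,R)$ of an acyclic subgraph $F$ of $G$ containing all vertices of $G$ and a set $R$ of vertices that contains exactly one vertex (the root) of each component of $F$. For real $x$, let $$\mathrm{rf}(G,x)=\sum_{(F,R)} x^{\lambda(F)},$$ where the sum is over all rooted spanning forests $(F,R)$ of $G$ and $\lambda(F)$ is the number of components of $F$. In particular, $\mathrm{rf}(G,1)$ is the number of rooted spanning forests of $G$. Then $G(D)$ is a tree with degree sequence $D$, and for every $x>0$ $$\mathrm{rf}(T,x)=\det(L(T)+xI_n),\qquad \mathrm{rf}(T,x)\ \ge\ \mathrm{rf}(G(D),x),$$ where $L(T)$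 is the Laplacian matrix of $T$ (degree matrix minus adjacency matrix). Equality holds in the inequality if and only if $T$ is isomorphic to $G(D)$. In particular, $T$ has at least as many rooted spanning forests as $G(D)$, with equality if and only if $T$ is isomorphic to $G(D)$. -/

import Mathlib

/-- `D` is the degree sequence of `G`: the list of all vertex degrees (with multiplicity), in
non-increasing order. -/
def HasDegreeSequence {V : Type*} [Fintype V] (G : SimpleGraph V) [DecidableRel G.Adj]
    (D : List ℕ) : Prop :=
  D.Pairwise (fun a b => b ≤ a) ∧
    (D : Multiset ℕ) = (Finset.univ : Finset V).val.map (fun v => G.degree v)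

/-- The number of new neighbours that vertex `i` receives in the greedy construction: all `d₀`
neighbours of the root `0` are new, while any later vertex already has one neighbour (its parent)
when its turn comes. -/
def greedyChildren (D : List ℕ) (i : ℕ) : ℕ :=
  if i = 0 then D.getD 0 0 else D.getD i 0 - 1

/-- The first label that is still unused when the turn of vertex `i` comes: label `0` went to the
root, and the vertices `0, …, i - 1` have each labelled their new neighbours. -/
def greedyNext (D : List ℕ) (i : ℕ) : ℕ :=
  1 + ∑ t ∈ Finset.range i, greedyChildren D t

/-- The greedy tree of the non-increasing degree sequence `D = [d₀, d₁, …]`. The vertices are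
`0, 1, 2, …` in the order in which the greedy algorithm labels them. A newly labelled vertex is
assigned the largest degree that is still available, so vertex `i` is assigned `dᵢ`. The labelled
vertex of largest degree whose neighbours are not labelled yet is then the earliest one, so the
vertices take turns in the order `0, 1, 2, …`; at its turn vertex `i` is joined to the next
`greedyChildren D i` unused labels. -/
def greedyTree (D : List ℕ) : SimpleGraph (Fin D.length) :=
  SimpleGraph.fromRel fun i j =>
    greedyNext D i ≤ (j : ℕ) ∧ (j : ℕ) < greedyNext D ((i : ℕ) + 1)

instance instDecidableRelGreedyTreeAdj (D : List ℕ) : DecidableRel (greedyTree D).Adj :=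
  fun i j => decidable_of_iff
    (i ≠ j ∧ ((greedyNext D i ≤ (j : ℕ) ∧ (j : ℕ) < greedyNext D ((i : ℕ) + 1)) ∨
      (greedyNext D j ≤ (i : ℕ) ∧ (i : ℕ) < greedyNext D ((j : ℕ) + 1)))) Iff.rfl

/-- `(F, R)` is a rooted spanning forest of `G`: `F` is an acyclic spanning subgraph of `G`
(on all vertices), and the set of roots `R` has exactly one element in each component of `F`. -/
def IsRootedSpanningForest {V : Type*} (G F : SimpleGraph V) (R : Finset V) : Prop :=
  F ≤ G ∧ F.IsAcyclic ∧
    ∀ c : F.ConnectedComponent, ∃! r : V, r ∈ R ∧ F.connectedComponentMk r = c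

open Classical in
/-- The finite set of all rooted spanning forests of `G`. -/
noncomputable def rootedSpanningForests {V : Type*} [Fintype V] (G : SimpleGraph V) :
    Finset (SimpleGraph V × Finset V) :=
  Finset.univ.filter fun p => IsRootedSpanningForest G p.1 p.2

/-- The weighted count `rf(G, x)` of rooted spanning forests: a rooted spanning forest with `k`
components has weight `x ^ k`. -/
noncomputable def rf {V : Type*} [Fintype V] (G : SimpleGraph V) (x : ℝ) : ℝ :=
  ∑ p ∈ rootedSpanningForests G, x ^ Nat.card p.1.ConnectedComponent

/-! Every row of `L + xI` is `x e_v` plus the sum of `e_v - e_w` over the neighbours `w`.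
Multilinearity expands the determinant over partial functions sending a vertex to a neighbour (its
parent) or to nothing (a root); functions with a cycle contribute zero. In an acyclic graph the
others correspond to rooted spanning forests, so `rf` is a determinant.

For the inequality, take a tree minimizing `rf` among those with the given degrees and let `G = (L +
xI)⁻¹`. Each branch hanging at a vertex `p` by a neighbour `y` has a ratio `ρ = G_yp / G_pp` in `(0,
1)`. Eliminating the branch leaves the conductance `1 - ρ` at `p`. Hence exchanging branches between
`u` and `v` changes `L + xI`, up to unimodular congruence, only by `δ (E_uu - E_vv)`, where `δ` is
the conductance gained at `u` (`shiftedLap_branchExchange`). The determinant is multiplied by `1 + δ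
(G_uu - G_vv) - δ² (G_uu G_vv - G_uv²)`, which is below `1` if `δ > 0` and `G_uu ≤ G_vv`.

So in a minimal tree no admissible exchange has positive gain at the vertex with smaller `G`. Single
swaps order the ratios, transfers of several branches order the degrees, and `G_yy = ρ + ρ² G_pp`
passes the order on to neighbours. Thus `a ↦ G_aa` is a greedy weight. Its minimum serves as root,
and a breadth-first order refining the weight identifies the tree with the greedy tree. Every
minimizer is therefore the greedy tree; since minimizers exist, the inequality and its equality case
follow. -/

open Finset Matrix

/-! ### Sides of edges in a tree. -/

namespace SimpleGraph

variable {V : Type*} {T : SimpleGraph V}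

/-- The vertices that can be reached from `y` without using the edge `py`. -/
def side (T : SimpleGraph V) (p y : V) : Set V :=
  {w | (T.deleteEdges {s(p, y)}).Reachable y w}

theorem Reachable.induction_closed {G : SimpleGraph V} {a b : V} (h : G.Reachable a b)
    (P : V → Prop) (ha : P a) (step : ∀ c d, G.Adj c d → P c → P d) : P b := by
  obtain ⟨w⟩ := h
  induction w with
  | nil => exact ha
  | cons hadj _ ih => exact ih (step _ _ hadj ha)

theorem Reachable.exists_adj_dist_lt {G : SimpleGraph V} {a r : V} (h : G.Reachable a r)
    (hne : a ≠ r) : ∃ w, G.Adj a w ∧ G.dist w r < G.dist a r := by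
  obtain ⟨p, hp⟩ := h.exists_walk_length_eq_dist
  cases p with
  | nil => exact absurd rfl hne
  | cons hw p =>
    refine ⟨_, hw, lt_of_le_of_lt (dist_le p) ?_⟩
    rw [← hp, Walk.length_cons]
    exact Nat.lt_succ_self _

theorem self_mem_side (p y : V) : y ∈ T.side p y := Reachable.refl _

theorem side_induction {p y w : V} (h : w ∈ T.side p y) (P : V → Prop) (hy : P y)
    (step : ∀ c d, T.Adj c d → s(c, d) ≠ s(p, y) → P c → P d) : P w :=
  Reachable.induction_closed h P hy fun c d hcd hc => by
    rw [deleteEdges_adj] at hcd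
    exact step c d hcd.1 hcd.2 hc

theorem mem_side_of_adj {p y w w' : V} (hw : w ∈ T.side p y) (h : T.Adj w w')
    (hne : s(w, w') ≠ s(p, y)) : w' ∈ T.side p y :=
  Reachable.trans hw (Adj.reachable (by rw [deleteEdges_adj]; exact ⟨h, hne⟩))

theorem IsAcyclic.notMem_side (hT : T.IsAcyclic) {p y : V} (h : T.Adj p y) : p ∉ T.side p y := by
  have hb := isAcyclic_iff_forall_adj_isBridge.1 hT h
  rw [isBridge_iff] at hb
  exact fun hr => hb (Reachable.symm hr)

/-- The only edge leaving a side is the one defining it. -/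
theorem IsAcyclic.eq_of_leave_side (hT : T.IsAcyclic) {p y w w' : V} (hp : T.Adj p y)
    (hw : w ∈ T.side p y) (h : T.Adj w w') (hw' : w' ∉ T.side p y) : w = y ∧ w' = p := by
  by_contra hcon
  refine hw' (mem_side_of_adj hw h fun he => ?_)
  rcases Sym2.eq_iff.1 he with ⟨rfl, rfl⟩ | ⟨rfl, rfl⟩
  · exact hT.notMem_side hp hw
  · exact hcon ⟨rfl, rfl⟩

theorem IsTree.notMem_side_iff (hT : T.IsTree) {p y w : V} (hp : T.Adj p y) :
    w ∉ T.side p y ↔ w ∈ T.side y p := by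
  constructor
  · intro hw
    refine ((hT.1.preconnected p w).induction_closed
      (fun a => a ∈ T.side p y ∨ a ∈ T.side y p) (Or.inr (self_mem_side _ _)) ?_).resolve_left hw
    rintro c d hcd (hc | hc)
    · by_cases hd : d ∈ T.side p y
      · exact Or.inl hd
      · obtain ⟨-, rfl⟩ := hT.2.eq_of_leave_side hp hc hcd hd
        exact Or.inr (self_mem_side _ _)
    · by_cases hd : d ∈ T.side y p
      · exact Or.inr hd
      · obtain ⟨-, rfl⟩ := hT.2.eq_of_leave_side hp.symm hc hcd hd
        exact Or.inl (self_mem_side _ _)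
  · intro hw
    refine side_induction hw (fun a => a ∉ T.side p y) (hT.2.notMem_side hp) ?_
    intro c d hcd hne hc hd
    obtain ⟨rfl, rfl⟩ := hT.2.eq_of_leave_side hp hd hcd.symm hc
    exact hne Sym2.eq_swap

theorem IsAcyclic.disjoint_side (hT : T.IsAcyclic) {a y y' w : V} (hy : T.Adj a y)
    (hy' : T.Adj a y') (hne : y ≠ y') (hw : w ∈ T.side a y) : w ∉ T.side a y' := by
  intro hw'
  refine (side_induction hw' (fun c => c ∉ T.side a y ∧ c ∈ T.side a y') ⟨fun h => ?_,
    self_mem_side _ _⟩ ?_).1 hw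
  · exact hne (hT.eq_of_leave_side hy h hy'.symm (hT.notMem_side hy)).1.symm
  · rintro c d hcd hs ⟨hc, hc'⟩
    have hd' := mem_side_of_adj hc' hcd hs
    refine ⟨fun hd => ?_, hd'⟩
    obtain ⟨rfl, rfl⟩ := hT.eq_of_leave_side hy hd hcd.symm hc
    exact hT.notMem_side hy' hc'

theorem IsTree.exists_mem_side (hT : T.IsTree) {a w : V} (hne : w ≠ a) :
    ∃ y, T.Adj a y ∧ w ∈ T.side a y := by
  refine ((hT.1.preconnected a w).induction_closed
      (fun c => c = a ∨ ∃ y, T.Adj a y ∧ c ∈ T.side a y) (Or.inl rfl) ?_).resolve_left hne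
  rintro c d hcd (rfl | ⟨y, hy, hc⟩)
  · exact Or.inr ⟨d, hcd, self_mem_side _ _⟩
  · by_cases hd : d ∈ T.side a y
    · exact Or.inr ⟨y, hy, hd⟩
    · exact Or.inl (hT.2.eq_of_leave_side hy hc hcd hd).2

theorem IsTree.side_eq (hT : T.IsTree) {a y y' w : V} (hy : T.Adj a y) (hy' : T.Adj a y')
    (hw : w ∈ T.side a y) (hw' : w ∈ T.side a y') : y = y' := by
  by_contra hne
  exact hT.2.disjoint_side hy hy' hne hw hw'

/-- Sides of edges at `u` and `v` that point away from each other are disjoint. -/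
theorem IsTree.disjoint_side_of_away (hT : T.IsTree) {u v y z w : V} (huv : u ≠ v)
    (hy : T.Adj u y) (hz : T.Adj v z) (hvy : v ∉ T.side u y) (huz : u ∉ T.side v z)
    (hw : w ∈ T.side u y) : w ∉ T.side v z := by
  refine (side_induction hw (fun c => c ∉ T.side v z ∧ c ∈ T.side u y)
    ⟨fun h => huv (hT.2.eq_of_leave_side hz h hy.symm huz).2, self_mem_side _ _⟩ ?_).1
  rintro c d hcd hs ⟨hc, hc'⟩
  refine ⟨fun hd => ?_, mem_side_of_adj hc' hcd hs⟩
  obtain ⟨rfl, rfl⟩ := hT.2.eq_of_leave_side hz hd hcd.symm hc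
  exact hvy hc'

end SimpleGraph

/-! ### Determinants of partial functions and expansion of the shifted Laplacian. -/

/-- The matrix of a partial function. -/
def partialFunMatrix {V : Type*} [DecidableEq V] (φ : V → Option V) : Matrix V V ℝ :=
  Matrix.of fun v w => if φ v = some w then 1 else 0

section PartialFunction

variable {V : Type*} [Fintype V] [DecidableEq V] {φ : V → Option V}

/-- Only the identity survives in the Leibniz sum. A contributing permutation `σ` fixes `v` or moves
it along `φ`; by induction along `φ` it fixes `σ v`, and injectivity then forces `σ v = v`. -/
theorem det_one_sub_partialFunMatrix_of_wf (h : WellFounded fun w v => φ v = some w) :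
    (1 - partialFunMatrix φ).det = 1 := by
  have hself : ∀ v, φ v ≠ some v := fun v hv => (h.irrefl.irrefl v) hv
  rw [← Matrix.det_transpose, Matrix.det_apply', Finset.sum_eq_single 1]
  · simp [partialFunMatrix, hself]
  · intro σ _ hσ
    by_contra hne
    have hprod := right_ne_zero_of_mul hne
    rw [Finset.prod_ne_zero_iff] at hprod
    refine hσ (Equiv.ext fun v => ?_)
    induction v using h.induction with
    | _ v ih =>
      by_contra hv
      have hv' : ¬ v = σ v := fun e => hv e.symm
      have h1 := hprod v (mem_univ v)
      have h2 : φ v = some (σ v) := by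
        by_contra h3
        simp [partialFunMatrix, h3, hv'] at h1
      have h4 := ih (σ v) h2
      exact hv (σ.injective h4)
  · simp

/-- The indicator of the non-accessible vertices is a nonzero kernel vector: a vertex is accessible
exactly when its image is, and a vertex without image always is. -/
theorem det_one_sub_partialFunMatrix_of_not_wf (h : ¬ WellFounded fun w v => φ v = some w) :
    (1 - partialFunMatrix φ).det = 0 := by
  classical
  rw [← Matrix.exists_mulVec_eq_zero_iff]
  refine ⟨fun v => if Acc (fun w v => φ v = some w) v then 0 else 1, ?_, ?_⟩
  · intro h0
    refine h ⟨fun v => ?_⟩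
    by_contra hv
    simpa [hv] using congrFun h0 v
  · ext v
    rw [Matrix.sub_mulVec, Matrix.one_mulVec]
    simp only [Matrix.mulVec, dotProduct, partialFunMatrix, Matrix.of_apply, Pi.sub_apply,
      Pi.zero_apply]
    cases hv : φ v with
    | none =>
      have : Acc (fun w v => φ v = some w) v := ⟨_, fun w hw => by simp [hv] at hw⟩
      simp [this]
    | some w =>
      have : Acc (fun w v => φ v = some w) v ↔ Acc (fun w v => φ v = some w) w :=
        ⟨fun a => a.inv hv, fun a => ⟨_, fun w' hw' => by
          obtain rfl : w = w' := by simpa [hv] using hw'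
          exact a⟩⟩
      simp only [this, Option.some.injEq, ite_mul, one_mul, zero_mul]
      rw [Finset.sum_ite_eq, if_pos (mem_univ w), sub_self]

end PartialFunction

namespace SimpleGraph

variable {V : Type*} [Fintype V] [DecidableEq V] (G : SimpleGraph V) [DecidableRel G.Adj]

/-- A choice of a neighbour or of nothing for every vertex, without cycles. -/
def IsParentFunction (φ : V → Option V) : Prop :=
  (∀ v w, φ v = some w → G.Adj v w) ∧ WellFounded fun w v => φ v = some w

open Classical in
/-- Expansion of the shifted Laplacian determinant over all parent functions. -/
theorem det_lapMatrix_add_eq_sum (x : ℝ) :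
    (G.lapMatrix ℝ + x • (1 : Matrix V V ℝ)).det =
      ∑ φ ∈ univ.filter G.IsParentFunction, x ^ #{v | φ v = none} := by
  -- Row `v` is split into one term per option: `none` gives `x e_v`, a neighbour `w` gives `e_v -
  -- e_w`, and a non-neighbour has coefficient zero.
  let c : V → Option V → ℝ := fun v o => o.elim x fun w => if G.Adj v w then 1 else 0
  let ro : V → Option V → V → ℝ := fun v o => (1 : Matrix V V ℝ) v -
    fun w => if o = some w then 1 else 0
  have hrow : G.lapMatrix ℝ + x • (1 : Matrix V V ℝ) = fun v => ∑ o, c v o • ro v o := by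
    ext v w
    rw [Fintype.sum_option]
    simp only [c, ro, Option.elim, Pi.add_apply, Finset.sum_apply, Pi.smul_apply, Pi.sub_apply,
      smul_eq_mul, Matrix.add_apply, Matrix.smul_apply, lapMatrix, degMatrix, Matrix.sub_apply,
      Matrix.diagonal_apply, adjMatrix_apply, Option.some.injEq, mul_sub, Finset.sum_sub_distrib,
      Matrix.one_apply, reduceCtorEq]
    rw [← Finset.sum_mul, ← degree_eq_sum_if_adj]
    simp only [mul_ite, mul_one, mul_zero, if_false, Finset.sum_ite_eq', mem_univ, if_true]
    ring
  have hdet : ∀ φ : V → Option V, Matrix.det (fun v => c v (φ v) • ro v (φ v)) =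
      if G.IsParentFunction φ then x ^ #{v | φ v = none} else 0 := by
    intro φ
    have h1 : Matrix.det (fun v => c v (φ v) • ro v (φ v)) =
        (∏ v, c v (φ v)) * (1 - partialFunMatrix φ).det :=
      Matrix.detRowAlternating.toMultilinearMap.map_smul_univ (fun v => c v (φ v))
        (fun v => ro v (φ v))
    rw [h1]
    split_ifs with h
    · rw [det_one_sub_partialFunMatrix_of_wf h.2, mul_one, Finset.card_filter,
        ← Finset.prod_pow_eq_pow_sum]
      refine Finset.prod_congr rfl fun v _ => ?_
      cases hv : φ v with
      | none => simp [c]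
      | some w => simp [c, h.1 v w hv]
    · by_cases hw : WellFounded fun w v => φ v = some w
      · have : ∃ v w, φ v = some w ∧ ¬ G.Adj v w := by
          by_contra hcon
          push Not at hcon
          exact h ⟨hcon, hw⟩
        obtain ⟨v, w, hvw, hadj⟩ := this
        rw [Finset.prod_eq_zero (mem_univ v) (by simp [c, hvw, hadj]), zero_mul]
      · rw [det_one_sub_partialFunMatrix_of_not_wf hw, mul_zero]
  rw [hrow]
  have := Matrix.detRowAlternating.toMultilinearMap.map_sum (R := ℝ) (fun v o => c v o • ro v o)
  refine Eq.trans this ?_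
  rw [Finset.sum_filter]
  exact Finset.sum_congr rfl fun φ _ => hdet φ

end SimpleGraph

/-! ### Parent functions and rooted spanning forests. -/

namespace SimpleGraph

variable {V : Type*} {T : SimpleGraph V} {φ ψ : V → Option V}

/-- The graph whose edges join every vertex to its parent. -/
def parentGraph (φ : V → Option V) : SimpleGraph V := fromRel fun v w => φ v = some w

theorem IsParentFunction.adj (h : T.IsParentFunction φ) {v w : V} (hv : φ v = some w) :
    (parentGraph φ).Adj v w := ⟨(h.1 v w hv).ne, Or.inl hv⟩

theorem IsParentFunction.parentGraph_le (h : T.IsParentFunction φ) : parentGraph φ ≤ T := by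
  rintro a b ⟨-, hab | hab⟩
  · exact h.1 _ _ hab
  · exact (h.1 _ _ hab).symm

theorem IsParentFunction.exists_root (h : T.IsParentFunction φ) (v : V) :
    ∃ r, φ r = none ∧ (parentGraph φ).Reachable v r := by
  induction v using h.2.induction with
  | _ v ih =>
    cases hv : φ v with
    | none => exact ⟨v, hv, Reachable.refl _⟩
    | some w =>
      obtain ⟨r, hr, hw⟩ := ih w hv
      exact ⟨r, hr, (h.adj hv).reachable.trans hw⟩

/-- Following parents until none is left gives an invariant of components that separates the roots;
this is what `root_unique` needs. -/
theorem IsParentFunction.exists_rootMap (h : T.IsParentFunction φ) :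
    ∃ ρ : V → V, (∀ v, φ v = none → ρ v = v) ∧ ∀ v w, φ v = some w → ρ v = ρ w := by
  classical
  have key : ∀ v, ∃! r, ∃ k, (fun o => Option.bind o φ)^[k] (some v) = some r ∧ φ r = none := by
    intro v
    induction v using h.2.induction with
    | _ v ih =>
      have hz : ∀ k, (fun o => Option.bind o φ)^[k] none = none := fun k =>
        Function.iterate_fixed rfl k
      cases hv : φ v with
      | none =>
        refine ⟨v, ⟨0, rfl, hv⟩, ?_⟩
        rintro r ⟨k, hk, -⟩
        cases k with
        | zero => simpa using hk.symm
        | succ k => rw [Function.iterate_succ_apply] at hk; simp [hv, hz] at hk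
      | some w =>
        obtain ⟨r, ⟨k, hk, hr⟩, hu⟩ := ih w hv
        refine ⟨r, ⟨k + 1, by rw [Function.iterate_succ_apply]; simpa [hv] using hk, hr⟩, ?_⟩
        rintro r' ⟨k', hk', hr'⟩
        refine hu r' ?_
        cases k' with
        | zero =>
          obtain rfl : v = r' := by simpa using hk'
          rw [hv] at hr'; cases hr'
        | succ k' => exact ⟨k', by rw [Function.iterate_succ_apply] at hk'; simpa [hv] using hk', hr'⟩
  choose ρ hρ hu using key
  refine ⟨ρ, fun v hv => (hu v v ⟨0, rfl, hv⟩).symm, fun v w hv => ?_⟩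
  obtain ⟨k, hk, hr⟩ := hρ w
  exact (hu v _ ⟨k + 1, by rw [Function.iterate_succ_apply]; simpa [hv] using hk, hr⟩).symm

theorem IsParentFunction.root_unique (h : T.IsParentFunction φ) {r r' : V} (hr : φ r = none)
    (hr' : φ r' = none) (hrr : (parentGraph φ).Reachable r r') : r = r' := by
  obtain ⟨ρ, h1, h2⟩ := h.exists_rootMap
  have : ρ r = ρ r' := hrr.induction_closed (fun a => ρ r = ρ a) rfl (by
    rintro c d ⟨-, hcd | hcd⟩ hc
    · rw [hc, h2 _ _ hcd]
    · rw [hc, h2 _ _ hcd])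
  rwa [h1 r hr, h1 r' hr'] at this

/-- An edge oriented oppositely by `φ` and `ψ` forces the next edge on the `φ`-path to be reversed
as well, because `ψ w` is already used up. The reversal thus travels up to a root of `φ`, which is a
root of `ψ` too, a contradiction. -/
theorem IsParentFunction.ne_of_parentGraph_eq (h : T.IsParentFunction φ)
    (hg : parentGraph φ = parentGraph ψ) (hR : ∀ v, φ v = none → ψ v = none) (w : V) :
    ∀ v, φ v = some w → ψ w ≠ some v := by
  induction w using h.2.induction with
  | _ w ih =>
    intro v hv hw
    cases hw2 : φ w with
    | none => rw [hR w hw2] at hw; cases hw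
    | some w2 =>
      have h1 := ih w2 hw2 w hw2
      have h2 : (parentGraph ψ).Adj w w2 := hg ▸ h.adj hw2
      rcases h2.2 with h3 | h3
      · obtain rfl : v = w2 := by rw [hw] at h3; exact Option.some.inj h3
        exact h.2.asymmetric _ _ hv hw2
      · exact h1 h3

theorem IsParentFunction.ext_of_parentGraph_eq (h : T.IsParentFunction φ)
    (hg : parentGraph φ = parentGraph ψ) (hR : ∀ v, φ v = none ↔ ψ v = none) : φ = ψ := by
  ext1 v
  cases hv : φ v with
  | none => exact ((hR v).1 hv).symm
  | some w =>
    have h2 : (parentGraph ψ).Adj v w := hg ▸ h.adj hv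
    rcases h2.2 with h3 | h3
    · exact h3.symm
    · exact absurd h3 (h.ne_of_parentGraph_eq hg (fun v => (hR v).1) w v hv)

theorem IsParentFunction.isRootedSpanningForest [Fintype V] [DecidableEq V] (hT : T.IsAcyclic) (h : T.IsParentFunction φ) :
    IsRootedSpanningForest T (parentGraph φ) {v | φ v = none} := by
  refine ⟨h.parentGraph_le, hT.anti h.parentGraph_le, fun c => ?_⟩
  induction c using ConnectedComponent.ind with
  | _ v =>
    obtain ⟨r, hr, hvr⟩ := h.exists_root v
    refine ⟨r, ⟨by simpa using hr, ConnectedComponent.sound hvr.symm⟩, ?_⟩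
    rintro r' ⟨hr', hc⟩
    exact h.root_unique (by simpa using hr') hr ((ConnectedComponent.exact hc).trans hvr)

end SimpleGraph

open SimpleGraph

theorem IsRootedSpanningForest.card_roots {V : Type*} {G F : SimpleGraph V} {R : Finset V}
    (h : IsRootedSpanningForest G F R) : Nat.card F.ConnectedComponent = #R := by
  rw [← Nat.card_eq_finsetCard R]
  refine (Nat.card_eq_of_bijective (fun r : R => F.connectedComponentMk r) ⟨?_, ?_⟩).symm
  · rintro ⟨r, hr⟩ ⟨r', hr'⟩ he
    exact Subtype.ext ((h.2.2 (F.connectedComponentMk r)).unique ⟨hr, rfl⟩ ⟨hr', he.symm⟩)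
  · intro c
    obtain ⟨r, ⟨hr, hc⟩, -⟩ := h.2.2 c
    exact ⟨⟨r, hr⟩, hc⟩

theorem IsRootedSpanningForest.exists_parentFunction {V : Type*} [Fintype V] [DecidableEq V]
    {G F : SimpleGraph V} {R : Finset V}
    (h : IsRootedSpanningForest G F R) :
    ∃ φ, G.IsParentFunction φ ∧ parentGraph φ = F ∧ ({v | φ v = none} : Finset V) = R := by
  obtain ⟨hle, hac, hroot⟩ := h
  choose ρ hρ hu using fun v => hroot (F.connectedComponentMk v)
  have hreach : ∀ v, F.Reachable v (ρ v) := fun v => (ConnectedComponent.exact (hρ v).2).symm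
  have hadj : ∀ {v w}, F.Adj v w → ρ v = ρ w := fun {v w} hvw =>
    hu w (ρ v) ⟨(hρ v).1, (hρ v).2.trans (ConnectedComponent.sound hvw.reachable)⟩
  have hmem : ∀ v, v ∈ R ↔ ρ v = v := fun v =>
    ⟨fun hv => (hu v v ⟨hv, rfl⟩).symm, fun hv => hv ▸ (hρ v).1⟩
  -- The parent is a neighbour closer to the root of the component, so the distance to the root
  -- proves well-foundedness.
  have hnext : ∀ v, v ∉ R → ∃ w, F.Adj v w ∧ F.dist w (ρ v) < F.dist v (ρ v) := by
    exact fun v hv => (hreach v).exists_adj_dist_lt fun e => hv ((hmem v).2 e.symm)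
  choose! nx hnx hdist using hnext
  let φ : V → Option V := fun v => if v ∈ R then none else some (nx v)
  have hsome : ∀ {v w}, φ v = some w → v ∉ R ∧ nx v = w := fun {v w} hvw => by
    by_cases hv : v ∈ R <;> simp_all [φ]
  have hnone : ∀ v, φ v = none ↔ v ∈ R := fun v => by simp [φ]
  have hφ : G.IsParentFunction φ := by
    refine ⟨fun v w hvw => ?_, ?_⟩
    · obtain ⟨hv, rfl⟩ := hsome hvw
      exact hle (hnx v hv)
    · refine Subrelation.wf (r := InvImage (· < ·) fun v => F.dist v (ρ v)) ?_
        (InvImage.wf _ wellFounded_lt)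
      intro w v hvw
      obtain ⟨hv, rfl⟩ := hsome hvw
      have := hdist v hv
      change F.dist (nx v) (ρ (nx v)) < F.dist v (ρ v)
      rwa [← hadj (hnx v hv)]
  have hsub : parentGraph φ ≤ F := by
    rintro a b ⟨-, hab | hab⟩
    · obtain ⟨hv, rfl⟩ := hsome hab; exact hnx _ hv
    · obtain ⟨hv, rfl⟩ := hsome hab; exact (hnx _ hv).symm
  refine ⟨φ, hφ, le_antisymm hsub fun a b hab => ?_, by ext v; simp [hnone]⟩
  -- Both ends of a missing edge reach their common root along parents, avoiding the edge; it would
  -- not be a bridge of the acyclic `F`.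
  by_contra hnot
  have hbr := isAcyclic_iff_forall_adj_isBridge.1 hac hab
  rw [isBridge_iff] at hbr
  obtain ⟨r, hr, har⟩ := hφ.exists_root a
  obtain ⟨r', hr', hbr'⟩ := hφ.exists_root b
  have e1 : ∀ {c s}, φ s = none → (parentGraph φ).Reachable c s → s = ρ c := fun {c s} hs hcs =>
    hu c s ⟨(hnone s).1 hs, (ConnectedComponent.sound (hcs.mono hsub)).symm⟩
  have hrr : r = r' := by rw [e1 hr har, e1 hr' hbr', hadj hab]
  subst hrr
  refine hbr ((har.trans hbr'.symm).mono fun c d hcd => ?_)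
  rw [deleteEdges_adj]
  refine ⟨hsub hcd, fun he => hnot ?_⟩
  rcases Sym2.eq_iff.1 he with ⟨rfl, rfl⟩ | ⟨rfl, rfl⟩
  · exact hcd
  · exact hcd.symm

/-- The matrix forest theorem for acyclic graphs. -/
theorem rf_eq_det {V : Type*} [Fintype V] [DecidableEq V] (T : SimpleGraph V)
    [DecidableRel T.Adj] (hT : T.IsAcyclic) (x : ℝ) :
    rf T x = (T.lapMatrix ℝ + x • (1 : Matrix V V ℝ)).det := by
  classical
  rw [det_lapMatrix_add_eq_sum, rf]
  symm
  refine Finset.sum_bij (fun φ _ => (parentGraph φ, ({v | φ v = none} : Finset V))) ?_ ?_ ?_ ?_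
  · intro φ hφ
    simp only [rootedSpanningForests, mem_filter, mem_univ, true_and] at hφ ⊢
    exact hφ.isRootedSpanningForest hT
  · intro φ hφ ψ hψ he
    simp only [mem_filter, mem_univ, true_and] at hφ hψ
    rw [Prod.mk.injEq] at he
    refine hφ.ext_of_parentGraph_eq he.1 fun v => ?_
    simpa using Finset.ext_iff.1 he.2 v
  · rintro ⟨F, R⟩ hp
    simp only [rootedSpanningForests, mem_filter, mem_univ, true_and] at hp
    obtain ⟨φ, h1, h2, h3⟩ := hp.exists_parentFunction
    exact ⟨φ, by simpa using h1, by rw [h2, h3]⟩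
  · intro φ hφ
    simp only [mem_filter, mem_univ, true_and] at hφ
    rw [(hφ.isRootedSpanningForest hT).card_roots]

/-! ### The Green matrix and the influence of a branch. -/

namespace SimpleGraph

section Green

variable {V : Type*} [Fintype V] [DecidableEq V] (T : SimpleGraph V) [DecidableRel T.Adj] (x : ℝ)

/-- The Laplacian shifted by `x`. -/
noncomputable def shiftedLap : Matrix V V ℝ := T.lapMatrix ℝ + x • (1 : Matrix V V ℝ)

/-- The Green matrix, the inverse of the shifted Laplacian. -/
noncomputable def green : Matrix V V ℝ := (T.shiftedLap x)⁻¹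

open Classical in
/-- The column of the Green matrix at `p`, normalised and cut off outside the side of `py`. -/
noncomputable def branchVec (p y : V) : V → ℝ :=
  fun w => if w ∈ T.side p y then T.green x w p / T.green x p p else 0

/-- The quotient of Green entries governing the influence of a branch. -/
noncomputable def branchRatio (p y : V) : ℝ := T.green x y p / T.green x p p

variable {T x}

theorem shiftedLap_apply (a b : V) : T.shiftedLap x a b =
    (if a = b then (T.degree a : ℝ) + x else 0) - if T.Adj a b then 1 else 0 := by
  simp only [shiftedLap, lapMatrix, degMatrix, Matrix.add_apply, Matrix.sub_apply,
    Matrix.diagonal_apply, adjMatrix_apply, Matrix.smul_apply, Matrix.one_apply, smul_eq_mul]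
  split_ifs <;> ring

theorem shiftedLap_mulVec_apply (f : V → ℝ) (a : V) : (T.shiftedLap x *ᵥ f) a =
    (T.degree a + x) * f a - ∑ b ∈ T.neighborFinset a, f b := by
  rw [shiftedLap, Matrix.add_mulVec, Pi.add_apply, lapMatrix_mulVec_apply, Matrix.smul_mulVec,
    Matrix.one_mulVec, Pi.smul_apply, smul_eq_mul]
  ring

theorem posDef_shiftedLap (hx : 0 < x) : (T.shiftedLap x).PosDef :=
  Matrix.PosDef.posSemidef_add (posSemidef_lapMatrix ℝ T) (Matrix.PosDef.one.smul hx)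

theorem posDef_green (hx : 0 < x) : (T.green x).PosDef := (posDef_shiftedLap hx).inv

theorem shiftedLap_symm (a b : V) : T.shiftedLap x a b = T.shiftedLap x b a := by
  rcases eq_or_ne a b with rfl | h
  · rfl
  · simp only [shiftedLap_apply, T.adj_comm a b, if_neg h, if_neg h.symm]

theorem green_diag_pos (hx : 0 < x) (a : V) : 0 < T.green x a a := (posDef_green hx).diag_pos

theorem det_shiftedLap_pos (hx : 0 < x) : 0 < (T.shiftedLap x).det := (posDef_shiftedLap hx).det_pos

theorem shiftedLap_mul_green (hx : 0 < x) : T.shiftedLap x * T.green x = 1 :=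
  Matrix.mul_nonsing_inv _ (det_shiftedLap_pos hx).ne'.isUnit

theorem green_mul_shiftedLap (hx : 0 < x) : T.green x * T.shiftedLap x = 1 :=
  Matrix.nonsing_inv_mul _ (det_shiftedLap_pos hx).ne'.isUnit

theorem shiftedLap_mulVec_green (hx : 0 < x) (p a : V) :
    (T.shiftedLap x *ᵥ fun w => T.green x w p) a = if a = p then 1 else 0 := by
  have := congrFun (congrFun (shiftedLap_mul_green (T := T) hx) a) p
  rwa [Matrix.one_apply] at this

theorem branchVec_eq_zero {p y w : V} (h : w ∉ T.side p y) : T.branchVec x p y w = 0 := if_neg h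

theorem branchVec_root {p y : V} : T.branchVec x p y y = T.branchRatio x p y :=
  if_pos (self_mem_side _ _)

/-- The column `G(·, p)` solves the homogeneous equation away from `p`. Cutting it off outside the
side of `y` disturbs this only at the two ends of the edge `py`, the only edge leaving the side. -/
theorem shiftedLap_mulVec_branchVec (hT : T.IsTree) (hx : 0 < x) {p y : V} (h : T.Adj p y) :
    T.shiftedLap x *ᵥ T.branchVec x p y =
      Pi.single y 1 - T.branchRatio x p y • Pi.single p 1 := by
  ext a
  have hc := (green_diag_pos (T := T) hx p).ne'
  have hf := shiftedLap_mulVec_green (T := T) hx p a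
  rw [shiftedLap_mulVec_apply] at hf ⊢
  simp only [Pi.sub_apply, Pi.smul_apply, Pi.single_apply, smul_eq_mul]
  have hp := hT.2.notMem_side h
  by_cases ha : a ∈ T.side p y
  · have hap : a ≠ p := fun e => hp (e ▸ ha)
    have hsum : ∑ b ∈ T.neighborFinset a, (T.green x b p / T.green x p p - T.branchVec x p y b) =
        if a = y then 1 else 0 := by
      split_ifs with hay
      · subst hay
        rw [Finset.sum_eq_single p]
        · rw [branchVec_eq_zero hp, div_self hc, sub_zero]
        · intro b hb hbp
          rw [mem_neighborFinset] at hb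
          have : b ∈ T.side p a := by
            by_contra hn
            exact hbp (hT.2.eq_of_leave_side h ha hb hn).2
          simp [branchVec, this]
        · intro hn
          exact absurd ((mem_neighborFinset _ _ _).2 h.symm) hn
      · refine Finset.sum_eq_zero fun b hb => ?_
        rw [mem_neighborFinset] at hb
        have : b ∈ T.side p y := by
          by_contra hn
          exact hay (hT.2.eq_of_leave_side h ha hb hn).1
        simp [branchVec, this]
    rw [Finset.sum_sub_distrib, ← Finset.sum_div] at hsum
    have h1 : T.branchVec x p y a = T.green x a p / T.green x p p := if_pos ha
    rw [if_neg hap] at hf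
    rw [h1, if_neg hap, ← hsum]
    have h2 : (T.degree a + x) * T.green x a p = ∑ b ∈ T.neighborFinset a, T.green x b p := by
      linarith
    rw [← h2]
    ring
  · have hay : a ≠ y := fun e => ha (e ▸ self_mem_side _ _)
    rw [branchVec_eq_zero ha, if_neg hay]
    have hsum : ∑ b ∈ T.neighborFinset a, T.branchVec x p y b =
        if a = p then T.branchRatio x p y else 0 := by
      split_ifs with hap
      · subst hap
        rw [Finset.sum_eq_single y, branchVec_root]
        · intro b hb hby
          rw [mem_neighborFinset] at hb
          refine branchVec_eq_zero fun hn => hby (hT.2.eq_of_leave_side h hn hb.symm ha).1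
        · intro hn
          exact absurd ((mem_neighborFinset _ _ _).2 h) hn
      · refine Finset.sum_eq_zero fun b hb => branchVec_eq_zero fun hn => ?_
        rw [mem_neighborFinset] at hb
        exact hap (hT.2.eq_of_leave_side h hn hb.symm ha).2
    rw [hsum]
    split_ifs <;> ring

/-- Apply the Green matrix to the equation of `branchVec` and read off the entry at `y`, using
symmetry only implicitly through `G_yp = ρ G_pp`. -/
theorem green_eq_branch (hT : T.IsTree) (hx : 0 < x) {p y : V} (h : T.Adj p y) :
    T.green x y y = T.branchRatio x p y + T.branchRatio x p y ^ 2 * T.green x p p := by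
  have h1 := congrArg (fun f => (T.green x *ᵥ f) y) (shiftedLap_mulVec_branchVec hT hx h)
  simp only [Matrix.mulVec_mulVec, green_mul_shiftedLap hx, Matrix.one_mulVec, branchVec_root,
    Matrix.mulVec_sub, Matrix.mulVec_smul, Matrix.mulVec_single_one, Pi.sub_apply, Pi.smul_apply,
    smul_eq_mul, Matrix.col_apply] at h1
  have hc := (green_diag_pos (T := T) hx p).ne'
  have h2 : T.green x y p = T.branchRatio x p y * T.green x p p := by
    rw [branchRatio, div_mul_cancel₀ _ hc]
  rw [h2] at h1
  linarith

/-- Energy estimate for the branch vector `f`: the quadratic form of the shifted Laplacian at `f`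
equals `g`, while the edge `py` alone contributes `g ^ 2` and the shift a positive amount. Hence `g
> g ^ 2`. -/
theorem branchRatio_mem (hT : T.IsTree) (hx : 0 < x) {p y : V} (h : T.Adj p y) :
    0 < T.branchRatio x p y ∧ T.branchRatio x p y < 1 := by
  set f := T.branchVec x p y with hf
  set g := T.branchRatio x p y with hg
  have hM := shiftedLap_mulVec_branchVec hT hx h
  rw [← hf, ← hg] at hM
  have hfp : f p = 0 := branchVec_eq_zero (hT.2.notMem_side h)
  have hfy : f y = g := branchVec_root
  have hf0 : f ≠ 0 := by
    intro h0
    have := congrFun hM y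
    simp [h0, h.ne'] at this
  have hquad : f ⬝ᵥ (T.shiftedLap x *ᵥ f) = g := by
    rw [hM, dotProduct_sub, dotProduct_smul, dotProduct_single_one, dotProduct_single_one, hfp, hfy]
    simp
  have hpos : 0 < f ⬝ᵥ f := by
    have := (Matrix.PosDef.one (n := V) (R := ℝ)).dotProduct_mulVec_pos hf0
    simpa using this
  have hL : f ⬝ᵥ (T.lapMatrix ℝ *ᵥ f) ≥ g ^ 2 := by
    rw [← Matrix.toLinearMap₂'_apply', lapMatrix_toLinearMap₂']
    have hnn : ∀ i, 0 ≤ ∑ j, if T.Adj i j then (f i - f j) ^ 2 else 0 := fun i =>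
      Finset.sum_nonneg fun j _ => by split_ifs <;> positivity
    have hle : ∀ i j, T.Adj i j →
        (f i - f j) ^ 2 ≤ ∑ j, if T.Adj i j then (f i - f j) ^ 2 else 0 := by
      intro i j hij
      refine le_trans (le_of_eq (if_pos hij).symm)
        (Finset.single_le_sum (f := fun j => if T.Adj i j then (f i - f j) ^ 2 else 0)
          (fun j _ => by split_ifs <;> positivity) (mem_univ j))
    have h2 := Finset.sum_le_sum_of_subset_of_nonneg (subset_univ ({p, y} : Finset V))
      (fun i _ _ => hnn i)
    rw [Finset.sum_pair h.ne] at h2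
    have h3 := hle p y h
    have h4 := hle y p h.symm
    rw [hfp, hfy] at h2 h3 h4
    rw [ge_iff_le, le_div_iff₀ two_pos]
    nlinarith
  have hsplit : f ⬝ᵥ (T.shiftedLap x *ᵥ f) = f ⬝ᵥ (T.lapMatrix ℝ *ᵥ f) + x * (f ⬝ᵥ f) := by
    rw [shiftedLap, Matrix.add_mulVec, dotProduct_add, Matrix.smul_mulVec, Matrix.one_mulVec,
      dotProduct_smul, smul_eq_mul]
  have hxf := mul_pos hx hpos
  rw [hquad] at hsplit
  have hg0 : 0 < g := by nlinarith [sq_nonneg g]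
  exact ⟨hg0, by nlinarith⟩

theorem green_lt_green_of_branch (hT : T.IsTree) (hx : 0 < x) {p q y z : V} (hy : T.Adj p y)
    (hz : T.Adj q z) (hr : T.branchRatio x p y ≤ T.branchRatio x q z)
    (hG : T.green x p p < T.green x q q) : T.green x y y < T.green x z z := by
  rw [green_eq_branch hT hx hy, green_eq_branch hT hx hz]
  have h1 := (branchRatio_mem hT hx hy).1
  have h2 := (branchRatio_mem hT hx hz).1
  have h3 := green_diag_pos (T := T) hx p
  have : T.branchRatio x p y ^ 2 * T.green x p p < T.branchRatio x q z ^ 2 * T.green x q q := by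
    refine lt_of_le_of_lt (b := T.branchRatio x q z ^ 2 * T.green x p p) ?_ ?_
    · gcongr
    · gcongr
  linarith

theorem green_le_green_of_branch (hT : T.IsTree) (hx : 0 < x) {p q y z : V} (hy : T.Adj p y)
    (hz : T.Adj q z) (hr : T.branchRatio x p y ≤ T.branchRatio x q z)
    (hG : T.green x p p ≤ T.green x q q) : T.green x y y ≤ T.green x z z := by
  rw [green_eq_branch hT hx hy, green_eq_branch hT hx hz]
  have h1 := (branchRatio_mem hT hx hy).1
  have h3 := green_diag_pos (T := T) hx p
  gcongr

end Green

end SimpleGraph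

/-! ### Shifting diagonal weight between two vertices. -/

/-- The perturbation has rank two, so the determinant lemma reduces the quotient of determinants to
a `2 × 2` determinant. Its quadratic term in `δ` is negative because the principal minor of `M⁻¹` at
`u, v` is positive. -/
theorem Matrix.PosDef.det_add_single_sub_single_lt {V : Type*} [Fintype V] [DecidableEq V]
    {M : Matrix V V ℝ} (hM : M.PosDef) {u v : V} (huv : u ≠ v) {δ : ℝ} (hδ : 0 < δ)
    (hle : M⁻¹ u u ≤ M⁻¹ v v) :
    (M + δ • (Matrix.single u u 1 - Matrix.single v v 1)).det < M.det := by
  let U : Matrix V (Fin 2) ℝ := Matrix.of fun a i => if i = 0 then (if a = u then δ else 0)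
    else if a = v then -δ else 0
  let W : Matrix (Fin 2) V ℝ := Matrix.of fun i a => if i = 0 then (if a = u then 1 else 0)
    else if a = v then 1 else 0
  have hUW : δ • (Matrix.single u u 1 - Matrix.single v v 1) = U * W := by
    ext a b
    simp only [U, W, Matrix.smul_apply, Matrix.sub_apply, Matrix.single_apply, Matrix.mul_apply,
      Fin.sum_univ_two, Matrix.of_apply, smul_eq_mul]
    simp
    grind
  have hG := hM.inv
  have hsym : M⁻¹ v u = M⁻¹ u v := by simpa using hG.isHermitian.apply u v
  have hminor : 0 < M⁻¹ u u * M⁻¹ v v - M⁻¹ u v * M⁻¹ v u := by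
    have := (hG.submatrix (e := ![u, v]) (by
      intro i j; fin_cases i <;> fin_cases j <;> simp [huv, huv.symm])).det_pos
    rw [Matrix.det_fin_two] at this
    simpa using this
  rw [hUW, Matrix.det_add_mul _ _ hM.det_pos.ne'.isUnit, Matrix.det_fin_two]
  have e : ∀ i j, (W * M⁻¹ * U) i j = M⁻¹ (![u, v] i) (![u, v] j) * ![δ, -δ] j := by
    intro i j
    fin_cases i <;> fin_cases j <;>
      simp [U, W, Matrix.mul_apply, mul_comm]
  simp only [Matrix.add_apply, e]
  simp only [Matrix.one_apply, hsym, Matrix.cons_val_zero, Matrix.cons_val_one]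
  rw [hsym] at hminor
  have : 0 < M.det := hM.det_pos
  have hs : 0 < δ ^ 2 * (M⁻¹ u u * M⁻¹ v v - M⁻¹ u v * M⁻¹ u v) := by positivity
  have hd : δ * (M⁻¹ u u - M⁻¹ v v) ≤ 0 := mul_nonpos_of_nonneg_of_nonpos hδ.le (by linarith)
  have : ∀ t < 1, M.det * t < M.det := fun t ht => by nlinarith
  refine this _ ?_
  simp
  nlinarith

/-! ### Exchanging branches between two vertices. -/

namespace SimpleGraph

section Exchange

variable {V : Type*} (T : SimpleGraph V) (u v : V) (Y Z : Finset V)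

/-- The pairs joining `p` to `Y` or `q` to `Z`. -/
def starPairs (p q : V) (Y Z : Finset V) (a b : V) : Prop :=
  (a = p ∧ b ∈ Y) ∨ (b = p ∧ a ∈ Y) ∨ (a = q ∧ b ∈ Z) ∨ (b = q ∧ a ∈ Z)

instance [DecidableEq V] (p q : V) (Y Z : Finset V) (a b : V) : Decidable (starPairs p q Y Z a b) :=
  inferInstanceAs (Decidable (_ ∨ _))

/-- The branches with roots `Y` are moved from `u` to `v`, those with roots `Z` from `v` to `u`. -/
def branchExchange : SimpleGraph V where
  Adj a b := a ≠ b ∧ ((T.Adj a b ∧ ¬ starPairs u v Y Z a b) ∨ starPairs v u Y Z a b)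
  symm := ⟨by
    rintro a b ⟨hne, h⟩
    have hs : ∀ p q, starPairs p q Y Z a b ↔ starPairs p q Y Z b a := by
      intro p q; simp only [starPairs]; tauto
    refine ⟨hne.symm, ?_⟩
    rwa [← hs, ← hs, T.adj_comm]⟩
  loopless := ⟨fun a h => h.1 rfl⟩

instance [DecidableEq V] [DecidableRel T.Adj] : DecidableRel (T.branchExchange u v Y Z).Adj :=
  fun a b => inferInstanceAs (Decidable (a ≠ b ∧ _))

/-- The sets `Y` and `Z` consist of neighbours of `u` and of `v`, in branches that point away from
the path between `u` and `v`. -/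
structure IsExchange : Prop where
  ne : u ≠ v
  adj_left : ∀ y ∈ Y, T.Adj u y
  away_left : ∀ y ∈ Y, v ∉ T.side u y
  adj_right : ∀ z ∈ Z, T.Adj v z
  away_right : ∀ z ∈ Z, u ∉ T.side v z

variable {T u v Y Z}

namespace IsExchange

theorem symm (h : T.IsExchange u v Y Z) : T.IsExchange v u Z Y :=
  ⟨h.ne.symm, h.adj_right, h.away_right, h.adj_left, h.away_left⟩

theorem left_notMem_left (h : T.IsExchange u v Y Z) : u ∉ Y := fun hu => (h.adj_left u hu).ne rfl

theorem left_notMem_right (h : T.IsExchange u v Y Z) : u ∉ Z := fun hu =>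
  h.away_right u hu (self_mem_side _ _)

theorem right_notMem_right (h : T.IsExchange u v Y Z) : v ∉ Z := h.symm.left_notMem_left

theorem right_notMem_left (h : T.IsExchange u v Y Z) : v ∉ Y := h.symm.left_notMem_right

theorem notMem_right (hT : T.IsTree) (h : T.IsExchange u v Y Z) {y : V} (hy : y ∈ Y) : y ∉ Z :=
  fun hz => hT.disjoint_side_of_away h.ne (h.adj_left y hy) (h.adj_right y hz) (h.away_left y hy)
    (h.away_right y hz) (self_mem_side _ _) (self_mem_side _ _)

theorem not_adj_right (hT : T.IsTree) (h : T.IsExchange u v Y Z) {y : V} (hy : y ∈ Y) :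
    ¬ T.Adj v y := fun hadj => h.ne (hT.2.eq_of_leave_side (h.adj_left y hy) (self_mem_side _ _)
      hadj.symm (h.away_left y hy)).2.symm

theorem not_adj_left (hT : T.IsTree) (h : T.IsExchange u v Y Z) {z : V} (hz : z ∈ Z) :
    ¬ T.Adj u z := h.symm.not_adj_right hT hz

/-- The exchanged graph is connected. -/
theorem connected (hT : T.IsTree) (h : T.IsExchange u v Y Z) :
    (T.branchExchange u v Y Z).Connected := by
  set T' := T.branchExchange u v Y Z with hT'
  have hkeep : ∀ a b, T.Adj a b → ¬ starPairs u v Y Z a b → T'.Adj a b := fun a b hab hs =>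
    ⟨hab.ne, Or.inl ⟨hab, hs⟩⟩
  have hvY : ∀ y ∈ Y, T'.Adj v y := fun y hy =>
    ⟨fun e => h.right_notMem_left (e ▸ hy), Or.inr (Or.inl ⟨rfl, hy⟩)⟩
  have huZ : ∀ z ∈ Z, T'.Adj u z := fun z hz =>
    ⟨fun e => h.left_notMem_right (e ▸ hz), Or.inr (Or.inr (Or.inr (Or.inl ⟨rfl, hz⟩)))⟩
  -- The tree without the edges to be moved. The path from `u` to `v` survives in it, since all
  -- moved branches point away from that path.
  let T0 : SimpleGraph V := fromRel fun a b => T.Adj a b ∧ ¬ starPairs u v Y Z a b ∧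
    ¬ starPairs u v Y Z b a
  have hT0 : ∀ a b, T0.Adj a b → T.Adj a b ∧ ¬ starPairs u v Y Z a b ∧
      ¬ starPairs u v Y Z b a := by
    rintro a b ⟨-, hab | hab⟩
    · exact hab
    · exact ⟨hab.1.symm, hab.2.2, hab.2.1⟩
  have hT0' : ∀ a b, T.Adj a b → T0.Adj a b ∨ starPairs u v Y Z a b := by
    intro a b hab
    by_cases hs : starPairs u v Y Z a b
    · exact Or.inr hs
    · refine Or.inl ⟨hab.ne, Or.inl ⟨hab, hs, fun hs' => hs ?_⟩⟩
      simp only [starPairs] at hs' ⊢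
      tauto
  have huv : T0.Reachable u v := by
    by_contra hnot
    have := (hT.1.preconnected u v).induction_closed
      (fun c => T0.Reachable u c ∨ ∃ y ∈ Y, c ∈ T.side u y) (Or.inl (Reachable.refl _)) (by
        rintro c d hcd (hc | ⟨y, hy, hc⟩)
        · rcases hT0' c d hcd with h0 | h0
          · exact Or.inl (hc.trans h0.reachable)
          · rcases h0 with ⟨rfl, hd⟩ | ⟨rfl, hcY⟩ | ⟨rfl, hd⟩ | ⟨rfl, hcZ⟩
            · exact Or.inr ⟨d, hd, self_mem_side _ _⟩
            · exact Or.inl (Reachable.refl _)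
            · exact absurd hc hnot
            · exfalso
              refine hc.induction_closed (fun e => e ∉ T.side d c) (h.away_right c hcZ) ?_
                (self_mem_side _ _)
              intro e f hef he hf
              obtain ⟨rfl, rfl⟩ := hT.2.eq_of_leave_side (h.adj_right _ hcZ) hf
                (hT0 _ _ hef).1.symm he
              exact (hT0 _ _ hef).2.1 (Or.inr (Or.inr (Or.inl ⟨rfl, hcZ⟩)))
        · by_cases hd : d ∈ T.side u y
          · exact Or.inr ⟨y, hy, hd⟩
          · obtain ⟨rfl, rfl⟩ := hT.2.eq_of_leave_side (h.adj_left y hy) hc hcd hd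
            exact Or.inl (Reachable.refl _))
    rcases this with h1 | ⟨y, hy, h1⟩
    · exact hnot h1
    · exact h.away_left y hy h1
  have huv' : T'.Reachable u v := huv.mono fun a b hab => hkeep a b (hT0 a b hab).1 (hT0 a b hab).2.1
  have hall : ∀ w, T'.Reachable u w := fun w => (hT.1.preconnected u w).induction_closed
    (fun c => T'.Reachable u c) (Reachable.refl _) (by
      intro c d hcd hc
      by_cases hs : starPairs u v Y Z c d
      · rcases hs with ⟨rfl, hd⟩ | ⟨rfl, hcY⟩ | ⟨rfl, hd⟩ | ⟨rfl, hcZ⟩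
        · exact huv'.trans (hvY d hd).reachable
        · exact Reachable.refl _
        · exact (huZ d hd).reachable
        · exact huv'
      · exact hc.trans (hkeep c d hcd hs).reachable)
  exact { preconnected := fun a b => (hall a).symm.trans (hall b), nonempty := ⟨u⟩ }

section Matrices

variable [DecidableEq V] [DecidableRel T.Adj]

variable (u v) in
/-- The difference of the indicators of `u` and `v`. -/
def poleVec : V → ℝ := fun a => (if a = u then 1 else 0) - if a = v then 1 else 0

variable (Y Z) in
/-- The difference of the indicators of `Y` and `Z`. -/
def rootVec : V → ℝ := fun a => (if a ∈ Y then 1 else 0) - if a ∈ Z then 1 else 0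

/-- The change is a symmetric rank-two matrix, since `Y` and `Z` are disjoint and no newly created
edge was already present. -/
theorem adj_indicator (hT : T.IsTree) (h : T.IsExchange u v Y Z) (a b : V) :
    (if (T.branchExchange u v Y Z).Adj a b then (1 : ℝ) else 0) =
      (if T.Adj a b then 1 else 0) - poleVec u v a * rootVec Y Z b -
        rootVec Y Z a * poleVec u v b := by
  have h1 := h.left_notMem_left
  have h2 := h.left_notMem_right
  have h3 := h.right_notMem_left
  have h4 := h.right_notMem_right
  have h5 : ∀ y ∈ Y, y ∉ Z := fun y hy => h.notMem_right hT hy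
  have h6 : ∀ y ∈ Y, ¬ T.Adj v y := fun y hy => h.not_adj_right hT hy
  have h7 : ∀ z ∈ Z, ¬ T.Adj u z := fun z hz => h.not_adj_left hT hz
  have h8 := h.adj_left
  have h9 := h.adj_right
  have h10 := h.ne
  have hs : ∀ a b, T.Adj a b ↔ T.Adj b a := T.adj_comm
  have hl : ∀ a, ¬ T.Adj a a := fun a => T.irrefl
  simp only [branchExchange, starPairs, poleVec, rootVec]
  grind

variable [Fintype V]

theorem sum_rootVec : ∑ a, rootVec Y Z a = (#Y : ℝ) - #Z := by
  simp [rootVec]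

theorem sum_poleVec : ∑ a, poleVec u v a = 0 := by
  simp [poleVec]

theorem degree_branchExchange (hT : T.IsTree) (h : T.IsExchange u v Y Z) (a : V) :
    ((T.branchExchange u v Y Z).degree a : ℝ) =
      T.degree a - poleVec u v a * ((#Y : ℝ) - #Z) := by
  rw [degree_eq_sum_if_adj, degree_eq_sum_if_adj]
  simp only [h.adj_indicator hT, Finset.sum_sub_distrib, ← Finset.mul_sum, sum_rootVec,
    sum_poleVec, mul_zero, sub_zero]

/-- The exchange preserves the sum of degrees, hence the number of edges, so connectedness suffices.
-/
theorem isTree (hT : T.IsTree) (h : T.IsExchange u v Y Z) : (T.branchExchange u v Y Z).IsTree := by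
  rw [isTree_iff_connected_and_card]
  refine ⟨h.connected hT, ?_⟩
  have h1 := T.sum_degrees_eq_twice_card_edges
  have h2 := (T.branchExchange u v Y Z).sum_degrees_eq_twice_card_edges
  have h3 := hT.card_edgeFinset
  have h4 : ∑ a, ((T.branchExchange u v Y Z).degree a : ℝ) = ∑ a, (T.degree a : ℝ) := by
    simp only [h.degree_branchExchange hT, Finset.sum_sub_distrib, ← Finset.sum_mul, sum_poleVec,
      zero_mul, sub_zero]
  have h5 : ∑ a, (T.branchExchange u v Y Z).degree a = ∑ a, T.degree a := by exact_mod_cast h4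
  rw [Nat.card_eq_fintype_card, Nat.card_eq_fintype_card, ← edgeFinset_card]
  omega

variable {x : ℝ}

/-- The gain of conductance at `u` in an exchange. -/
noncomputable def gain (T : SimpleGraph V) [DecidableRel T.Adj] (x : ℝ) (u v : V)
    (Y Z : Finset V) : ℝ :=
  ∑ z ∈ Z, (1 - T.branchRatio x v z) - ∑ y ∈ Y, (1 - T.branchRatio x u y)

/-- Write `c` for `poleVec u v`. Adding to a potential `f` the vector `(f u - f v) k`, with `k` the
branch vectors of `Y` minus those of `Z`, adapts it on the moved branches to their new attachment
points. What remains is the change of conductance at the poles. As `c ⬝ᵥ k = 0`, both outer factors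
have determinant one. -/
theorem shiftedLap_branchExchange (hT : T.IsTree) (hx : 0 < x) (h : T.IsExchange u v Y Z) :
    ∃ k : V → ℝ, poleVec u v ⬝ᵥ k = 0 ∧
      (T.branchExchange u v Y Z).shiftedLap x =
        (1 + vecMulVec (poleVec u v) k) *
          (T.shiftedLap x + gain T x u v Y Z • (Matrix.single u u 1 - Matrix.single v v 1)) *
          (1 + vecMulVec k (poleVec u v)) := by
  set gY := ∑ y ∈ Y, T.branchRatio x u y with hgY
  set gZ := ∑ z ∈ Z, T.branchRatio x v z with hgZ
  set k : V → ℝ := ∑ y ∈ Y, T.branchVec x u y - ∑ z ∈ Z, T.branchVec x v z with hk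
  have hku : k u = 0 := by
    simp only [hk, Pi.sub_apply, Finset.sum_apply]
    rw [Finset.sum_eq_zero, Finset.sum_eq_zero, sub_zero]
    · exact fun z hz => branchVec_eq_zero (h.away_right z hz)
    · exact fun y hy => branchVec_eq_zero (hT.2.notMem_side (h.adj_left y hy))
  have hkv : k v = 0 := by
    simp only [hk, Pi.sub_apply, Finset.sum_apply]
    rw [Finset.sum_eq_zero, Finset.sum_eq_zero, sub_zero]
    · exact fun z hz => branchVec_eq_zero (hT.2.notMem_side (h.adj_right z hz))
    · exact fun y hy => branchVec_eq_zero (h.away_left y hy)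
  have hkY : ∀ y ∈ Y, k y = T.branchRatio x u y := by
    intro y hy
    simp only [hk, Pi.sub_apply, Finset.sum_apply]
    rw [Finset.sum_eq_single_of_mem y hy, Finset.sum_eq_zero, sub_zero, branchVec_root]
    · intro z hz
      exact branchVec_eq_zero (hT.disjoint_side_of_away h.ne (h.adj_left y hy) (h.adj_right z hz)
        (h.away_left y hy) (h.away_right z hz) (self_mem_side _ _))
    · intro y' hy' hne
      exact branchVec_eq_zero (hT.2.disjoint_side (h.adj_left y hy) (h.adj_left y' hy') hne.symm
        (self_mem_side _ _))
  have hkZ : ∀ z ∈ Z, k z = - T.branchRatio x v z := by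
    intro z hz
    simp only [hk, Pi.sub_apply, Finset.sum_apply]
    rw [Finset.sum_eq_single_of_mem z hz, Finset.sum_eq_zero, zero_sub, branchVec_root]
    · intro y hy
      exact branchVec_eq_zero (hT.disjoint_side_of_away h.ne.symm (h.adj_right z hz)
        (h.adj_left y hy) (h.away_right z hz) (h.away_left y hy) (self_mem_side _ _))
    · intro z' hz' hne
      exact branchVec_eq_zero (hT.2.disjoint_side (h.adj_right z hz) (h.adj_right z' hz') hne.symm
        (self_mem_side _ _))
  set N := T.shiftedLap x + gain T x u v Y Z • (Matrix.single u u 1 - Matrix.single v v 1) with hN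
  have hMk : T.shiftedLap x *ᵥ k = fun a => rootVec Y Z a - gY * (if a = u then 1 else 0) +
      gZ * if a = v then 1 else 0 := by
    rw [hk, Matrix.mulVec_sub, Matrix.mulVec_sum, Matrix.mulVec_sum,
      Finset.sum_congr rfl fun y hy => shiftedLap_mulVec_branchVec hT hx (h.adj_left y hy),
      Finset.sum_congr rfl fun z hz => shiftedLap_mulVec_branchVec hT hx (h.adj_right z hz)]
    ext a
    simp only [Pi.sub_apply, Finset.sum_apply, Pi.smul_apply, Pi.single_apply, smul_eq_mul,
      Finset.sum_sub_distrib, ← Finset.sum_mul, rootVec, Finset.sum_ite_eq]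
    ring
  -- The vector `k` vanishes at `u` and `v`, so it does not see the diagonal perturbation.
  have hNk : N *ᵥ k = T.shiftedLap x *ᵥ k := by
    rw [hN, Matrix.add_mulVec, Matrix.smul_mulVec, Matrix.sub_mulVec]
    ext a
    simp [Matrix.single_mulVec, hku, hkv]
  have hkN : k ᵥ* N = T.shiftedLap x *ᵥ k := by
    rw [← hNk, ← Matrix.mulVec_transpose]
    congr 1
    ext a b
    simp only [hN, Matrix.transpose_apply, Matrix.add_apply, shiftedLap_symm a b,
      Matrix.smul_apply, Matrix.sub_apply, Matrix.single_apply, and_comm]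
  have hkMk : k ⬝ᵥ (T.shiftedLap x *ᵥ k) = gY + gZ := by
    rw [hMk]
    simp only [dotProduct, mul_add, mul_sub, Finset.sum_add_distrib, Finset.sum_sub_distrib,
      rootVec, mul_ite, mul_one, mul_zero, Finset.sum_ite_eq', mem_univ, if_true, hku, hkv,
      zero_mul, Finset.sum_ite_mem, Finset.univ_inter]
    rw [Finset.sum_congr rfl hkY, Finset.sum_congr rfl hkZ, Finset.sum_neg_distrib]
    ring
  have hgain : gain T x u v Y Z = (#Z : ℝ) - gZ - (#Y - gY) := by
    simp [gain, Finset.sum_sub_distrib, hgY, hgZ]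
  refine ⟨k, ?_, ?_⟩
  · simp [poleVec, dotProduct, sub_mul, Finset.sum_sub_distrib, hku, hkv]
  have hexp : (1 + vecMulVec (poleVec u v) k) * N * (1 + vecMulVec k (poleVec u v)) =
      N + vecMulVec (poleVec u v) (T.shiftedLap x *ᵥ k) +
        vecMulVec (T.shiftedLap x *ᵥ k) (poleVec u v) +
        (gY + gZ) • vecMulVec (poleVec u v) (poleVec u v) := by
    rw [add_mul, one_mul, Matrix.vecMulVec_mul, hkN, mul_add, mul_one, add_mul,
      Matrix.mul_vecMulVec, hNk, Matrix.vecMulVec_mul_vecMulVec, ← hkMk, dotProduct_comm k]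
    rw [Matrix.vecMulVec_smul]
    abel
  rw [hexp, hMk]
  ext a b
  simp only [shiftedLap_apply, Matrix.add_apply, hN, Matrix.smul_apply, vecMulVec_apply,
    h.degree_branchExchange hT, h.adj_indicator hT, hgain, Matrix.sub_apply, Matrix.single_apply,
    smul_eq_mul]
  generalize T.shiftedLap x *ᵥ k = m at *
  have hne := h.ne
  generalize rootVec Y Z a = ra
  generalize rootVec Y Z b = rb
  simp only [poleVec]
  grind

/-- An exchange that increases the conductance at the pole with the smaller Green entry decreases
the determinant. -/
theorem det_lt (hT : T.IsTree) (hx : 0 < x) (h : T.IsExchange u v Y Z)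
    (hG : T.green x u u ≤ T.green x v v) (hgain : 0 < gain T x u v Y Z) :
    ((T.branchExchange u v Y Z).shiftedLap x).det < (T.shiftedLap x).det := by
  obtain ⟨k, hk, hM⟩ := h.shiftedLap_branchExchange hT hx
  have h1 : (1 + vecMulVec (poleVec u v) k).det = 1 := by
    rw [vecMulVec_eq Unit, Matrix.det_one_add_replicateCol_mul_replicateRow, dotProduct_comm, hk,
      add_zero]
  have h2 : (1 + vecMulVec k (poleVec u v)).det = 1 := by
    rw [vecMulVec_eq Unit, Matrix.det_one_add_replicateCol_mul_replicateRow, hk, add_zero]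
  rw [hM, Matrix.det_mul, Matrix.det_mul, h1, h2, one_mul, mul_one]
  exact (posDef_shiftedLap hx).det_add_single_sub_single_lt h.ne hgain hG

end Matrices

end IsExchange

end Exchange

end SimpleGraph

/-! ### Minimal trees have a greedy weight. -/

theorem HasDegreeSequence.of_degree_comp_equiv {V W : Type*} [Fintype V] [Fintype W]
    {G : SimpleGraph V} {H : SimpleGraph W} [DecidableRel G.Adj] [DecidableRel H.Adj] {D : List ℕ}
    (h : HasDegreeSequence G D) (e : W ≃ V) (he : ∀ w, H.degree w = G.degree (e w)) :
    HasDegreeSequence H D := by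
  refine ⟨h.1, h.2.trans ?_⟩
  rw [← Multiset.map_univ_val_equiv e, Multiset.map_map]
  exact Multiset.map_congr rfl fun w _ => (he w).symm

namespace SimpleGraph

/-- A weight on the vertices of a tree that is compatible with degrees and with passing to
neighbours away from each other; smaller weights are closer to the root of a greedy tree. -/
structure IsGreedyWeight {V : Type*} [Fintype V] (T : SimpleGraph V) [DecidableRel T.Adj]
    (s : V → ℝ) : Prop where
  degree_le : ∀ {u v}, s u ≤ s v → T.degree v ≤ T.degree u
  le : ∀ {u v y z}, u ≠ v → T.Adj u y → T.Adj v z → v ∉ T.side u y → u ∉ T.side v z →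
    s u ≤ s v → s y ≤ s z
  lt : ∀ {u v y z}, u ≠ v → T.Adj u y → T.Adj v z → v ∉ T.side u y → u ∉ T.side v z →
    s u < s v → s y < s z

theorem IsTree.degree_pos_of_ne {V : Type*} [Fintype V] {T : SimpleGraph V}
    [DecidableRel T.Adj] (hT : T.IsTree) {u v : V} (huv : u ≠ v) : 0 < T.degree u := by
  obtain ⟨y, hy, -⟩ := hT.exists_mem_side huv.symm
  exact (T.degree_pos_iff_exists_adj u).2 ⟨y, hy⟩

variable {V : Type*} [Fintype V] [DecidableEq V] {T : SimpleGraph V} [DecidableRel T.Adj]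
  {D : List ℕ} {x : ℝ}

theorem IsTree.rf_eq_det_shiftedLap (hT : T.IsTree) (x : ℝ) : rf T x = (T.shiftedLap x).det :=
  rf_eq_det T hT.2 x

/-- `T` has the least value of `rf` among the trees with degree sequence `D`. -/
def IsMinimalTree (T : SimpleGraph V) (D : List ℕ) (x : ℝ) : Prop :=
  ∀ (T' : SimpleGraph V) [DecidableRel T'.Adj], T'.IsTree → HasDegreeSequence T' D →
    rf T x ≤ rf T' x

theorem IsMinimalTree.gain_le (hmin : T.IsMinimalTree D x) (hT : T.IsTree)
    (hD : HasDegreeSequence T D) (hx : 0 < x) {u v : V} {Y Z : Finset V}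
    (h : T.IsExchange u v Y Z) (hG : T.green x u u ≤ T.green x v v)
    (hcard : #Y = #Z ∨ T.degree v + #Y = T.degree u + #Z) :
    IsExchange.gain T x u v Y Z ≤ 0 := by
  by_contra! hgain
  have hT' := h.isTree hT
  refine absurd (hmin _ hT' ?_) (not_le.2 ?_)
  · have hdeg := h.degree_branchExchange hT
    -- With equally many branches moved each way all degrees stay; in the other case `u` and `v`
    -- interchange their degrees.
    rcases hcard with hc | hc
    · refine hD.of_degree_comp_equiv (Equiv.refl V) fun w => ?_
      have := hdeg w
      rw [hc, sub_self, mul_zero, sub_zero] at this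
      exact_mod_cast this
    · refine hD.of_degree_comp_equiv (Equiv.swap u v) fun w => ?_
      have h1 := hdeg w
      have h2 : (T.degree v : ℝ) + #Y = T.degree u + #Z := by exact_mod_cast hc
      have h3 := h.ne
      suffices ((T.branchExchange u v Y Z).degree w : ℝ) = T.degree (Equiv.swap u v w) by
        exact_mod_cast this
      rw [h1, IsExchange.poleVec]
      by_cases hu : w = u
      · subst hu
        rw [Equiv.swap_apply_left, if_pos rfl, if_neg h3]
        linarith
      · by_cases hv : w = v
        · subst hv
          rw [Equiv.swap_apply_right, if_pos rfl, if_neg hu]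
          linarith
        · rw [Equiv.swap_apply_of_ne_of_ne hu hv, if_neg hu, if_neg hv]
          ring
  · rw [hT'.rf_eq_det_shiftedLap, hT.rf_eq_det_shiftedLap]
    exact h.det_lt hT hx hG hgain

theorem IsMinimalTree.branchRatio_le (hmin : T.IsMinimalTree D x) (hT : T.IsTree)
    (hD : HasDegreeSequence T D) (hx : 0 < x) {u v y z : V} (huv : u ≠ v)
    (hy : T.Adj u y) (hz : T.Adj v z) (hvy : v ∉ T.side u y) (huz : u ∉ T.side v z)
    (hG : T.green x u u ≤ T.green x v v) : T.branchRatio x u y ≤ T.branchRatio x v z := by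
  have h : T.IsExchange u v {y} {z} := by
    refine ⟨huv, ?_, ?_, ?_, ?_⟩ <;> simpa
  have := hmin.gain_le hT hD hx h hG (Or.inl (by simp))
  rw [IsExchange.gain, Finset.sum_singleton, Finset.sum_singleton] at this
  linarith

/-- Otherwise the surplus of branches at `v` pointing away from `u` could be moved to `u`. This
swaps the two degrees, and the gain is positive since all ratios are below one. Enough branches are
available because `u` has degree at least one. -/
theorem IsMinimalTree.degree_le (hmin : T.IsMinimalTree D x) (hT : T.IsTree)
    (hD : HasDegreeSequence T D) (hx : 0 < x) {u v : V} (huv : u ≠ v)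
    (hG : T.green x u u ≤ T.green x v v) : T.degree v ≤ T.degree u := by
  by_contra! hlt
  have hu := hT.degree_pos_of_ne huv
  obtain ⟨z0, hz0, hmem⟩ := hT.exists_mem_side huv
  obtain ⟨Z, hZ, hcard⟩ : ∃ Z ⊆ (T.neighborFinset v).erase z0, #Z = T.degree v - T.degree u := by
    refine Finset.exists_subset_card_eq ?_
    rw [Finset.card_erase_of_mem ((mem_neighborFinset _ _ _).2 hz0), card_neighborFinset_eq_degree]
    omega
  have hadj : ∀ z ∈ Z, T.Adj v z := fun z hz =>
    (mem_neighborFinset _ _ _).1 (Finset.mem_of_mem_erase (hZ hz))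
  have h : T.IsExchange u v ∅ Z := by
    refine ⟨huv, by simp, by simp, hadj, fun z hz => ?_⟩
    exact hT.2.disjoint_side hz0 (hadj z hz) (Finset.ne_of_mem_erase (hZ hz)).symm hmem
  have h1 := hmin.gain_le hT hD hx h hG (Or.inr (by rw [hcard, Finset.card_empty]; omega))
  rw [IsExchange.gain, Finset.sum_empty, sub_zero] at h1
  refine absurd h1 (not_le.2 (Finset.sum_pos (fun z hz => ?_) ?_))
  · linarith [(branchRatio_mem hT hx (hadj z hz)).2]
  · rw [← Finset.card_pos]; omega

theorem IsMinimalTree.isGreedyWeight (hmin : T.IsMinimalTree D x) (hT : T.IsTree)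
    (hD : HasDegreeSequence T D) (hx : 0 < x) : T.IsGreedyWeight fun a => T.green x a a where
  degree_le {u v} h := by
    rcases eq_or_ne u v with rfl | huv
    · exact le_rfl
    · exact hmin.degree_le hT hD hx huv h
  le huv hy hz hvy huz h := green_le_green_of_branch hT hx hy hz
    (hmin.branchRatio_le hT hD hx huv hy hz hvy huz h) h
  lt huv hy hz hvy huz h := green_lt_green_of_branch hT hx hy hz
    (hmin.branchRatio_le hT hD hx huv hy hz hvy huz h.le) h

end SimpleGraph

/-! ### From a greedy weight to a breadth-first order. -/

namespace SimpleGraph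

variable {V : Type*} {T : SimpleGraph V} {r : V} {par : V → V}

/-- `par` maps every vertex other than the root `r` to its neighbour in the direction of `r`. -/
structure IsParentMap (T : SimpleGraph V) (r : V) (par : V → V) : Prop where
  adj : ∀ {a}, a ≠ r → T.Adj a (par a)
  mem_side : ∀ {a}, a ≠ r → r ∈ T.side a (par a)

theorem IsTree.exists_isParentMap (hT : T.IsTree) (r : V) : ∃ par, T.IsParentMap r par := by
  have : ∀ a, a ≠ r → ∃ y, T.Adj a y ∧ r ∈ T.side a y := fun a ha => hT.exists_mem_side ha.symm
  choose! par h1 h2 using this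
  exact ⟨par, fun {a} => h1 a, fun {a} => h2 a⟩

/-- A geodesic from `w` to `r` stays closer to `r` than `a`, so it avoids `a` and the edge `aw`. -/
theorem IsTree.mem_side_of_dist_lt (hT : T.IsTree) {a w r : V}
    (h : T.dist w r < T.dist a r) : r ∈ T.side a w := by
  have key : ∀ k t, T.dist t r ≤ k → T.dist t r < T.dist a r →
      (T.deleteEdges {s(a, w)}).Reachable t r := by
    intro k
    induction k with
    | zero =>
      intro t ht _
      obtain rfl : t = r := (hT.1.dist_eq_zero_iff).1 (Nat.le_zero.1 ht)
      exact Reachable.refl _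
    | succ k ih =>
      intro t ht hta
      rcases eq_or_ne t r with rfl | hne
      · exact Reachable.refl _
      obtain ⟨t', hadj, hlt⟩ := (hT.1.preconnected t r).exists_adj_dist_lt hne
      refine Reachable.trans (Adj.reachable ?_) (ih t' (by omega) (by omega))
      rw [deleteEdges_adj]
      refine ⟨hadj, fun he => ?_⟩
      rcases Sym2.eq_iff.1 he with ⟨rfl, -⟩ | ⟨-, rfl⟩ <;> omega
  exact key _ w le_rfl h

namespace IsParentMap

theorem dist_lt (hT : T.IsTree) (h : T.IsParentMap r par) {a : V} (ha : a ≠ r) :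
    T.dist (par a) r < T.dist a r := by
  obtain ⟨w, hw, hlt⟩ := (hT.1.preconnected a r).exists_adj_dist_lt ha
  rwa [hT.side_eq (h.adj ha) hw (h.mem_side ha) (hT.mem_side_of_dist_lt hlt)]

theorem adj_iff (hT : T.IsTree) (h : T.IsParentMap r par) {a b : V} :
    T.Adj a b ↔ (a ≠ r ∧ par a = b) ∨ (b ≠ r ∧ par b = a) := by
  constructor
  · intro hab
    by_cases hr : r ∈ T.side a b
    · have ha : a ≠ r := fun e => hT.2.notMem_side hab (e ▸ hr)
      exact Or.inl ⟨ha, hT.side_eq (h.adj ha) hab (h.mem_side ha) hr⟩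
    · rw [hT.notMem_side_iff hab] at hr
      have hb : b ≠ r := fun e => hT.2.notMem_side hab.symm (e ▸ hr)
      exact Or.inr ⟨hb, hT.side_eq (h.adj hb) hab.symm (h.mem_side hb) hr⟩
  · rintro (⟨ha, rfl⟩ | ⟨hb, rfl⟩)
    · exact h.adj ha
    · exact (h.adj hb).symm

theorem root_notMem (hT : T.IsTree) (h : T.IsParentMap r par) {u : V} (hu : u ≠ r) :
    r ∉ T.side (par u) u := (hT.notMem_side_iff (h.adj hu).symm).2 (h.mem_side hu)

theorem par_mem_side (hT : T.IsTree) (h : T.IsParentMap r par) {u w : V} (hu : u ≠ r)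
    (hw : w ∈ T.side (par u) u) (hne : w ≠ u) : w ≠ r ∧ par w ∈ T.side (par u) u := by
  have hwr : w ≠ r := fun e => h.root_notMem hT hu (e ▸ hw)
  refine ⟨hwr, ?_⟩
  by_contra hn
  exact hne (hT.2.eq_of_leave_side (h.adj hu).symm hw (h.adj hwr) hn).1

theorem side_subset (hT : T.IsTree) (h : T.IsParentMap r par) {u : V} (hu : u ≠ r)
    (hp : par u ≠ r) : T.side (par u) u ⊆ T.side (par (par u)) (par u) := by
  intro w hw
  refine (side_induction hw (fun c => c ∈ T.side (par u) u ∧ c ∈ T.side (par (par u)) (par u))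
    ⟨self_mem_side _ _, ?_⟩ ?_).2
  · by_contra hn
    have := (hT.2.eq_of_leave_side (h.adj hp).symm (self_mem_side _ _) (h.adj hu).symm hn).2
    have h1 := h.dist_lt hT hu
    have h2 := h.dist_lt hT hp
    rw [← this] at h2
    omega
  · rintro c d hcd hs ⟨hc, hc'⟩
    refine ⟨mem_side_of_adj hc hcd hs, ?_⟩
    by_contra hn
    have := (hT.2.eq_of_leave_side (h.adj hp).symm hc' hcd hn).1
    exact hT.2.notMem_side (h.adj hu).symm (this ▸ hc)

variable [Fintype V] [DecidableRel T.Adj] {s : V → ℝ}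

/-- A greedy weight is minimal at the top of each branch. -/
theorem weight_le (hT : T.IsTree) (h : T.IsParentMap r par) (hs : T.IsGreedyWeight s)
    (hr : ∀ a, s r ≤ s a) {u w : V} (hu : u ≠ r) (hw : w ∈ T.side (par u) u) : s u ≤ s w := by
  classical
  induction hk : T.dist u r using Nat.strong_induction_on generalizing u w with
  | _ k ih =>
    -- A lighter `w` below `u` has degree at least that of `u`, hence at least two, and so a
    -- neighbour `w'` pointing away from `u`. Comparing the steps `w → w'` and `u → par u` makes
    -- `w'` lighter than `par u` in the branch of `par u`, against induction or the minimality of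
    -- the root.
    by_contra! hlt
    have hwu : w ≠ u := fun e => hlt.ne (e ▸ rfl)
    have hadj := h.adj hu
    have hdeg := hs.degree_le hlt.le
    have hwp : w ∉ T.side u (par u) := fun hw' =>
      (hT.notMem_side_iff hadj.symm).2 hw' hw
    obtain ⟨c, hc, hwc⟩ := hT.exists_mem_side hwu
    have h2 : 2 ≤ T.degree u := by
      have hsub : ({c, par u} : Finset V) ⊆ T.neighborFinset u := by
        intro d hd
        rw [mem_neighborFinset]
        rcases Finset.mem_insert.1 hd with rfl | hd
        · exact hc
        · rw [Finset.mem_singleton.1 hd]; exact hadj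
      have hne : c ≠ par u := fun e => hwp (e ▸ hwc)
      simpa [Finset.card_pair hne] using Finset.card_le_card hsub
    obtain ⟨y0, hy0, huy0⟩ := hT.exists_mem_side hwu.symm
    obtain ⟨w', hw'⟩ : ((T.neighborFinset w).erase y0).Nonempty := by
      rw [← Finset.card_pos, Finset.card_erase_of_mem ((mem_neighborFinset _ _ _).2 hy0),
        card_neighborFinset_eq_degree]
      omega
    have hadj' : T.Adj w w' := (mem_neighborFinset _ _ _).1 (Finset.mem_of_mem_erase hw')
    have haway := hT.2.disjoint_side hy0 hadj' (Finset.ne_of_mem_erase hw').symm huy0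
    have hlt' := hs.lt hwu hadj' hadj haway hwp hlt
    by_cases hp : par u = r
    · rw [hp] at hlt'
      exact absurd (hr w') (not_le.2 hlt')
    · refine absurd (ih _ (hk ▸ h.dist_lt hT hu) hp (w := w') ?_ rfl) (not_le.2 hlt')
      refine h.side_subset hT hu hp ?_
      by_contra hn
      exact hwu (hT.2.eq_of_leave_side hadj.symm hw hadj' hn).1

end IsParentMap

/-- The data of a breadth-first order in which parents keep the order and degrees decrease. -/
structure IsGreedyCode (T : SimpleGraph V) [Fintype V] [DecidableRel T.Adj] (r : V) (par : V → V)
    (code : V → ℕ) : Prop where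
  injective : Function.Injective code
  root_le : ∀ a, code r ≤ code a
  par_lt : ∀ {a}, a ≠ r → code (par a) < code a
  par_le : ∀ {a b}, a ≠ r → b ≠ r → code a ≤ code b → code (par a) ≤ code (par b)
  degree_le : ∀ {a b}, code a ≤ code b → T.degree b ≤ T.degree a
  adj_iff : ∀ {a b}, T.Adj a b ↔ (a ≠ r ∧ par a = b) ∨ (b ≠ r ∧ par b = a)

end SimpleGraph

/-- Ties are broken by an arbitrary enumeration, and a vertex is ranked by the number of smaller
keys. -/
theorem exists_ranking {V : Type*} [Fintype V] (s : V → ℝ) :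
    ∃ σ : V → ℕ, Function.Injective σ ∧ (∀ a, σ a < Fintype.card V + 1) ∧
      ∀ a b, σ a < σ b → s a ≤ s b := by
  classical
  let e := Fintype.equivFin V
  let key : V → ℝ ×ₗ Fin (Fintype.card V) := fun a => toLex (s a, e a)
  have hkey : Function.Injective key := fun a b hab => by
    have := congrArg (fun p => (ofLex p).2) hab
    exact e.injective this
  have hmono : ∀ a b, key a < key b → #{c | key c < key a} < #{c | key c < key b} := by
    intro a b hab
    refine Finset.card_lt_card ⟨fun c hc => ?_, fun hsub => ?_⟩
    · simp only [mem_filter, mem_univ, true_and] at hc ⊢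
      exact hc.trans hab
    · have := hsub (x := a) (by simpa using hab)
      simp at this
  refine ⟨fun a => #{c | key c < key a}, fun a b hab => ?_, fun a => ?_, fun a b hab => ?_⟩
  · rcases lt_trichotomy (key a) (key b) with h | h | h
    · exact absurd hab (hmono a b h).ne
    · exact hkey h
    · exact absurd hab (hmono b a h).ne'
  · exact Nat.lt_succ_of_le (Finset.card_le_univ _)
  · have : key a < key b := by
      by_contra! hba
      rcases hba.eq_or_lt with h | h
      · rw [hkey h] at hab; exact lt_irrefl _ hab
      · exact lt_asymm hab (hmono b a h)
    rcases (Prod.Lex.lt_iff).1 this with h | h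
    · exact h.le
    · exact h.1.le

namespace SimpleGraph

variable {V : Type*} [Fintype V] {T : SimpleGraph V} [DecidableRel T.Adj] {s : V → ℝ}

theorem IsGreedyWeight.exists_isGreedyCode (hs : T.IsGreedyWeight s) (hT : T.IsTree) :
    ∃ r par code, T.IsGreedyCode r par code := by
  classical
  have := hT.1.nonempty
  obtain ⟨r, hr⟩ := Finite.exists_min s
  obtain ⟨par, h⟩ := hT.exists_isParentMap r
  obtain ⟨σ, hσ, hσN, hσs⟩ := exists_ranking s
  set N := Fintype.card V + 1 with hN
  have hN2 : 2 ≤ N := by have := Fintype.card_pos (α := V); omega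
  -- The code is the path from the root written in base `N` with digits `σ`. The leading digit `1`
  -- makes longer paths larger, so the order is by depth and then lexicographic. The extra `1` in
  -- `N` keeps the base at least two.
  obtain ⟨code, hroot, hcode⟩ : ∃ code : V → ℕ, code r = 1 ∧
      ∀ a, a ≠ r → code a = code (par a) * N + σ a := by
    let wf := (measure fun a => T.dist a r).wf
    let F : ∀ a, (∀ b, T.dist b r < T.dist a r → ℕ) → ℕ := fun a rec =>
      if ha : a = r then 1 else rec (par a) (h.dist_lt hT ha) * N + σ a
    refine ⟨wf.fix F, ?_, fun a ha => ?_⟩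
    · rw [wf.fix_eq]; exact dif_pos rfl
    · rw [wf.fix_eq]; exact dif_neg ha
  have hpos : ∀ a, 1 ≤ code a := by
    intro a
    induction hk : T.dist a r using Nat.strong_induction_on generalizing a with
    | _ k ih =>
      by_cases ha : a = r
      · rw [ha, hroot]
      · rw [hcode a ha]
        have := ih _ (hk ▸ h.dist_lt hT ha) (par a) rfl
        nlinarith
  have hlt : ∀ {a}, a ≠ r → code (par a) < code a := fun {a} ha => by
    rw [hcode a ha]
    have := hpos (par a)
    nlinarith
  have hchild : ∀ {a b}, a ≠ r → b ≠ r → code (par a) < code (par b) → code a < code b := by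
    intro a b ha hb hab
    rw [hcode a ha, hcode b hb]
    have := hσN a
    nlinarith
  have hle : ∀ {a b}, a ≠ r → b ≠ r → code a ≤ code b → code (par a) ≤ code (par b) :=
    fun ha hb hab => not_lt.1 fun hn => absurd hab (not_le.2 (hchild hb ha hn))
  have hinj : ∀ a b, code a = code b → a = b := by
    intro a
    induction hk : T.dist a r using Nat.strong_induction_on generalizing a with
    | _ k ih =>
      intro b hab
      by_cases ha : a = r
      · by_contra hne
        have hb : b ≠ r := fun e => hne (ha.trans e.symm)
        have h1 := hlt hb
        have h2 := hpos (par b)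
        rw [← hab, ha, hroot] at h1
        omega
      · have hb : b ≠ r := by
          rintro rfl
          have h1 := hlt ha
          have h2 := hpos (par a)
          rw [hab, hroot] at h1
          omega
        have hpar : code (par a) = code (par b) := le_antisymm (hle ha hb hab.le) (hle hb ha hab.ge)
        rw [hcode a ha, hcode b hb, hpar] at hab
        exact hσ (Nat.add_left_cancel hab)
  have hside : ∀ u w, u ≠ r → w ∈ T.side (par u) u → code u ≤ code w := by
    intro u w hu
    induction hk : T.dist w r using Nat.strong_induction_on generalizing w with
    | _ k ih =>
      intro hw
      by_cases hwu : w = u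
      · rw [hwu]
      · obtain ⟨hwr, hpw⟩ := h.par_mem_side hT hu hw hwu
        exact (ih _ (hk ▸ h.dist_lt hT hwr) (par w) rfl hpw).trans (hlt hwr).le
  -- For different parents, induction compares the parents. Then either the branches of `a` and `b`
  -- point away from each other and the weight passes to the children, or `b` lies in the branch of
  -- `a`, where `a` is lightest.
  have hweight : ∀ b a, code a ≤ code b → s a ≤ s b := by
    intro b
    induction hk : code b using Nat.strong_induction_on generalizing b with
    | _ k ih =>
      intro a hab
      rw [← hk] at hab
      by_cases ha : a = r
      · rw [ha]; exact hr b
      have hb : b ≠ r := by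
        rintro rfl
        have h1 := hlt ha
        have h2 := hpos (par a)
        omega
      have hpab := hle ha hb hab
      by_cases hpp : par a = par b
      · rw [hcode a ha, hcode b hb, hpp] at hab
        rcases (Nat.le_of_add_le_add_left hab).eq_or_lt with h1 | h1
        · rw [hσ h1]
        · exact hσs a b h1
      have hs' := ih _ (hk ▸ hlt hb) (par b) rfl (par a) hpab
      have hbside : par a ∉ T.side (par b) b := fun hm => by
        have h1 := hside b (par a) hb hm
        have h2 := hlt hb
        omega
      by_cases haside : par b ∈ T.side (par a) a
      · refine h.weight_le hT hs hr ha ?_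
        by_contra hn
        have := (hT.2.eq_of_leave_side (h.adj ha).symm haside (h.adj hb).symm hn).2
        rw [this] at hbside
        exact hbside (self_mem_side _ _)
      · exact hs.le hpp (h.adj ha).symm (h.adj hb).symm haside hbside hs'
  exact ⟨r, par, code, fun a b => hinj a b, fun a => hroot ▸ hpos a, hlt, hle,
    fun hab => hs.degree_le (hweight _ _ hab), h.adj_iff hT⟩

end SimpleGraph

/-! ### Recognizing the greedy labelling. -/

/-- The number of labels whose parent comes before `i`. -/
theorem greedyNext_eq_card {D : List ℕ} (q : Fin D.length → Fin D.length)
    (hchildren : ∀ i : Fin D.length,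
      greedyChildren D i = #{k : Fin D.length | (k : ℕ) ≠ 0 ∧ q k = i}) {i : ℕ}
    (hi : i ≤ D.length) :
    greedyNext D i = 1 + #{k : Fin D.length | (k : ℕ) ≠ 0 ∧ (q k : ℕ) < i} := by
  induction i with
  | zero => simp [greedyNext]
  | succ i ih =>
    have h1 : greedyNext D (i + 1) = greedyNext D i + greedyChildren D i := by
      rw [greedyNext, greedyNext, Finset.sum_range_succ, add_assoc]
    have h2 := hchildren ⟨i, hi⟩
    rw [h1, ih (by omega), h2, add_assoc, ← Finset.card_union_of_disjoint]
    · congr 2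
      ext k
      simp only [mem_union, mem_filter, mem_univ, true_and, Fin.ext_iff]
      omega
    · rw [Finset.disjoint_left]
      intro k hk hk'
      simp only [mem_filter, mem_univ, true_and, Fin.ext_iff] at hk hk'
      omega

/-- With monotone parents, the nonzero labels whose parent precedes `i` form an initial segment, so
membership is decided by their number. -/
theorem par_lt_iff_lt_greedyNext {D : List ℕ} (q : Fin D.length → Fin D.length)
    (hchildren : ∀ i : Fin D.length,
      greedyChildren D i = #{k : Fin D.length | (k : ℕ) ≠ 0 ∧ q k = i})
    (hmono : ∀ i j : Fin D.length, (i : ℕ) ≠ 0 → i ≤ j → q i ≤ q j) {i : ℕ} (hi : i ≤ D.length)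
    {j : Fin D.length} (hj : (j : ℕ) ≠ 0) : (q j : ℕ) < i ↔ (j : ℕ) < greedyNext D i := by
  rw [greedyNext_eq_card q hchildren hi]
  have h0 : 0 < D.length := j.pos
  constructor
  · intro h
    have hsub : Finset.Ioc (⟨0, h0⟩ : Fin D.length) j ⊆
        ({k : Fin D.length | (k : ℕ) ≠ 0 ∧ (q k : ℕ) < i} : Finset _) := by
      intro k hk
      rw [Finset.mem_Ioc, Fin.lt_def] at hk
      have hk0 : (k : ℕ) ≠ 0 := Nat.pos_iff_ne_zero.1 hk.1
      simp only [mem_filter, mem_univ, true_and]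
      exact ⟨hk0, lt_of_le_of_lt (Fin.le_def.1 (hmono k j hk0 hk.2)) h⟩
    have := Finset.card_le_card hsub
    rw [Fin.card_Ioc] at this
    simp only [Nat.sub_zero] at this
    omega
  · intro h
    by_contra hn
    have hsub : ({k : Fin D.length | (k : ℕ) ≠ 0 ∧ (q k : ℕ) < i} : Finset _) ⊆
        Finset.Ioo (⟨0, h0⟩ : Fin D.length) j := by
      intro k hk
      simp only [mem_filter, mem_univ, true_and] at hk
      rw [Finset.mem_Ioo, Fin.lt_def]
      refine ⟨Nat.pos_of_ne_zero hk.1, ?_⟩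
      by_contra hjk
      have := Fin.le_def.1 (hmono j k hj (not_lt.1 hjk))
      omega
    have := Finset.card_le_card hsub
    rw [Fin.card_Ioo] at this
    simp only [Nat.sub_zero] at this
    omega

/-- A graph on the labels with monotone parents and degrees given by `D` is the greedy tree. -/
theorem eq_greedyTree {D : List ℕ} {H : SimpleGraph (Fin D.length)} [DecidableRel H.Adj]
    {q : Fin D.length → Fin D.length}
    (hlt : ∀ i : Fin D.length, (i : ℕ) ≠ 0 → q i < i)
    (hmono : ∀ i j : Fin D.length, (i : ℕ) ≠ 0 → i ≤ j → q i ≤ q j)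
    (hadj : ∀ i j, H.Adj i j ↔ ((i : ℕ) ≠ 0 ∧ q i = j) ∨ ((j : ℕ) ≠ 0 ∧ q j = i))
    (hdeg : ∀ i : Fin D.length, D.getD i 0 = H.degree i) : H = greedyTree D := by
  have hchildren : ∀ i : Fin D.length,
      greedyChildren D i = #{k : Fin D.length | (k : ℕ) ≠ 0 ∧ q k = i} := by
    intro i
    rw [greedyChildren]
    split_ifs with hi
    · have hd := hdeg i
      rw [hi] at hd
      rw [hd, ← SimpleGraph.card_neighborFinset_eq_degree]
      refine congrArg Finset.card (Finset.ext fun k => ?_)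
      simp [hadj, hi]
    · rw [hdeg, ← SimpleGraph.card_neighborFinset_eq_degree,
        ← Finset.card_erase_of_mem (a := q i) (by
        rw [SimpleGraph.mem_neighborFinset, hadj]; exact Or.inl ⟨hi, rfl⟩)]
      refine congrArg Finset.card (Finset.ext fun k => ?_)
      simp only [mem_erase, SimpleGraph.mem_neighborFinset, hadj, mem_filter, mem_univ, true_and]
      constructor
      · rintro ⟨hk, ⟨-, h⟩ | h⟩
        · exact absurd h.symm hk
        · exact h
      · rintro ⟨hk, h⟩
        refine ⟨fun e => ?_, Or.inr ⟨hk, h⟩⟩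
        have h1 := hlt i hi
        have h2 := hlt k hk
        rw [h, e] at h2
        exact lt_asymm h1 h2
  have hkey : ∀ i j : Fin D.length,
      (greedyNext D i ≤ (j : ℕ) ∧ (j : ℕ) < greedyNext D ((i : ℕ) + 1)) ↔
        ((j : ℕ) ≠ 0 ∧ q j = i) := by
    intro i j
    by_cases hj : (j : ℕ) = 0
    · have : 1 ≤ greedyNext D i := Nat.le_add_right _ _
      simp only [hj, ne_eq, not_true, false_and, iff_false]
      omega
    · rw [← par_lt_iff_lt_greedyNext q hchildren hmono i.2 hj, ← not_lt,
        ← par_lt_iff_lt_greedyNext q hchildren hmono i.2.le hj, Fin.ext_iff]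
      omega
  ext i j
  rw [greedyTree, SimpleGraph.fromRel_adj, hkey, hkey, hadj]
  constructor
  · intro h
    refine ⟨?_, h.symm⟩
    rintro rfl
    rcases h with h | h <;> exact (hlt _ h.1).ne h.2
  · exact fun h => h.2.symm

/-! ### Identification with the greedy tree and conclusion. -/

namespace SimpleGraph

variable {V : Type*} [Fintype V] {T : SimpleGraph V} [DecidableRel T.Adj] {D : List ℕ}

theorem IsGreedyCode.nonempty_iso {r : V} {par : V → V} {code : V → ℕ}
    (h : T.IsGreedyCode r par code) (hD : HasDegreeSequence T D) :
    Nonempty (T ≃g greedyTree D) := by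
  classical
  have hlen : D.length = Fintype.card V := by
    have := congrArg Multiset.card hD.2
    simpa using this
  obtain ⟨e, he⟩ : ∃ e : V ≃ Fin D.length, ∀ a b, e a ≤ e b ↔ code a ≤ code b := by
    let _ : LinearOrder V := LinearOrder.lift' code h.injective
    exact ⟨(Fintype.orderIsoFinOfCardEq V hlen.symm).symm.toEquiv,
      fun a b => (Fintype.orderIsoFinOfCardEq V hlen.symm).symm.le_iff_le⟩
  have he' : ∀ a b, e a < e b ↔ code a < code b := fun a b => by
    rw [← not_le, he, not_le]
  -- Degrees decrease along the code order, and a multiset has only one non-increasing arrangement.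
  have hDeq : D = List.ofFn fun i => T.degree (e.symm i) := by
    refine List.Perm.eq_of_pairwise (le := fun a b => b ≤ a) (fun a b _ _ h1 h2 => le_antisymm h2 h1)
      hD.1 ?_ ?_
    · rw [List.pairwise_ofFn]
      intro i j hij
      refine h.degree_le ((he _ _).1 ?_)
      simpa using hij.le
    · rw [← Multiset.coe_eq_coe, hD.2, ← Fin.univ_val_map, ← Multiset.map_univ_val_equiv e.symm,
        Multiset.map_map]
      rfl
  have hroot : ∀ i : Fin D.length, (i : ℕ) ≠ 0 ↔ e.symm i ≠ r := by
    intro i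
    have hr0 : (e r : ℕ) = 0 := by
      have := (he r (e.symm ⟨0, i.pos⟩)).2 (h.root_le _)
      rw [Equiv.apply_symm_apply, Fin.le_def] at this
      exact Nat.le_zero.1 this
    rw [not_iff_not, Equiv.symm_apply_eq, Fin.ext_iff, hr0]
  let H : SimpleGraph (Fin D.length) := T.comap e.symm
  let iso : H ≃g T := ⟨e.symm, Iff.rfl⟩
  have hH : H = greedyTree D := by
    refine eq_greedyTree (q := fun i => e (par (e.symm i))) ?_ ?_ ?_ ?_
    · intro i hi
      have := (he' _ _).2 (h.par_lt ((hroot i).1 hi))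
      rwa [Equiv.apply_symm_apply] at this
    · intro i j hi hij
      have hj : (j : ℕ) ≠ 0 := by rw [Fin.le_def] at hij; omega
      refine (he _ _).2 (h.par_le ((hroot i).1 hi) ((hroot j).1 hj) ((he _ _).1 ?_))
      simpa using hij
    · intro i j
      rw [hroot, hroot, ← Equiv.eq_symm_apply, ← Equiv.eq_symm_apply]
      exact h.adj_iff
    · intro i
      rw [← iso.degree_eq i]
      refine (congrArg (fun l : List ℕ => l.getD (i : ℕ) 0) hDeq).trans ?_
      have hi : (i : ℕ) < (List.ofFn fun i => T.degree (e.symm i)).length := by simp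
      rw [List.getD_eq_getElem _ _ hi, List.getElem_ofFn]
      rfl
  exact ⟨hH ▸ iso.symm⟩

theorem IsMinimalTree.nonempty_iso [DecidableEq V] {x : ℝ} (hmin : T.IsMinimalTree D x)
    (hT : T.IsTree) (hD : HasDegreeSequence T D) (hx : 0 < x) :
    Nonempty (T ≃g greedyTree D) := by
  obtain ⟨r, par, code, h⟩ := (hmin.isGreedyWeight hT hD hx).exists_isGreedyCode hT
  exact h.nonempty_iso hD

theorem exists_isMinimalTree (hT : T.IsTree) (hD : HasDegreeSequence T D) (x : ℝ) :
    ∃ (T₀ : SimpleGraph V) (_ : DecidableRel T₀.Adj), T₀.IsTree ∧ HasDegreeSequence T₀ D ∧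
      T₀.IsMinimalTree D x := by
  classical
  obtain ⟨T₀, h0, hmin⟩ := Finset.exists_min_image
    ({T' : SimpleGraph V | T'.IsTree ∧ HasDegreeSequence T' D} : Finset (SimpleGraph V))
    (fun T' => rf T' x) ⟨T, by
      simp only [mem_filter, mem_univ, true_and]
      exact ⟨hT, by convert hD⟩⟩
  simp only [mem_filter, mem_univ, true_and] at h0 hmin
  exact ⟨T₀, inferInstance, h0.1, h0.2, fun T' _ h1 h2 => hmin T' ⟨h1, by convert h2⟩⟩

theorem Iso.rf_eq {W : Type*} [Fintype W] {H : SimpleGraph W} (f : T ≃g H) (hT : T.IsTree)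
    (x : ℝ) : rf T x = rf H x := by
  classical
  have hH := f.isTree_iff.1 hT
  rw [hT.rf_eq_det_shiftedLap, hH.rf_eq_det_shiftedLap,
    ← Matrix.det_submatrix_equiv_self f.toEquiv (H.shiftedLap x)]
  congr 1
  ext a b
  have h1 : H.Adj (f a) (f b) ↔ T.Adj a b := f.map_adj_iff
  have h2 : f a = f b ↔ a = b := f.injective.eq_iff
  change _ = H.shiftedLap x (f a) (f b)
  simp only [shiftedLap_apply, h1, h2, f.degree_eq]

/-- Some minimizer exists and is the greedy tree, which gives the bound. A tree attaining it is
itself a minimizer, hence also the greedy tree. -/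
theorem rf_greedyTree_le (hT : T.IsTree) (hD : HasDegreeSequence T D) {x : ℝ} (hx : 0 < x) :
    rf (greedyTree D) x ≤ rf T x ∧
      (rf T x = rf (greedyTree D) x ↔ Nonempty (T ≃g greedyTree D)) := by
  classical
  obtain ⟨T₀, _, h1, h2, hmin⟩ := exists_isMinimalTree hT hD x
  obtain ⟨f⟩ := hmin.nonempty_iso h1 h2 hx
  have hf := f.rf_eq h1 x
  refine ⟨hf ▸ hmin T hT hD, fun heq => ?_, fun ⟨g⟩ => g.rf_eq hT x⟩
  have hmin' : T.IsMinimalTree D x := fun T' _ ht hd => by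
    rw [heq, ← hf]
    exact hmin T' ht hd
  exact hmin'.nonempty_iso hT hD hx

/-- The properties are transported from a minimizer, for the arbitrary choice `x = 1`, rather than
checked on the algorithm. -/
theorem isTree_greedyTree (hT : T.IsTree) (hD : HasDegreeSequence T D) :
    (greedyTree D).IsTree ∧ HasDegreeSequence (greedyTree D) D := by
  classical
  obtain ⟨T₀, _, h1, h2, hmin⟩ := exists_isMinimalTree hT hD 1
  obtain ⟨f⟩ := hmin.nonempty_iso h1 h2 one_pos
  exact ⟨f.isTree_iff.1 h1, h2.of_degree_comp_equiv f.symm.toEquiv fun w => (f.symm.degree_eq w).symm⟩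

end SimpleGraph

theorem rf_one {V : Type*} [Fintype V] (G : SimpleGraph V) :
    rf G 1 = (rootedSpanningForests G).card := by
  simp [rf]

theorem theorem2p8 {V : Type*} [Fintype V] [DecidableEq V]
    (T : SimpleGraph V) [DecidableRel T.Adj] (hT : T.IsTree)
    (D : List ℕ) (hD : HasDegreeSequence T D) :
    -- the greedy tree is one of the trees with degree sequence `D`
    ((greedyTree D).IsTree ∧ HasDegreeSequence (greedyTree D) D) ∧
    (∀ x : ℝ, 0 < x →
      rf T x = (T.lapMatrix ℝ + x • (1 : Matrix V V ℝ)).det ∧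
      rf (greedyTree D) x ≤ rf T x ∧
      (rf T x = rf (greedyTree D) x ↔ Nonempty (T ≃g greedyTree D))) ∧
    -- the total number of rooted spanning forests
    (rootedSpanningForests (greedyTree D)).card ≤ (rootedSpanningForests T).card ∧
    ((rootedSpanningForests T).card = (rootedSpanningForests (greedyTree D)).card ↔
      Nonempty (T ≃g greedyTree D)) := by
  refine ⟨SimpleGraph.isTree_greedyTree hT hD,
    fun x hx => ⟨rf_eq_det T hT.2 x, SimpleGraph.rf_greedyTree_le hT hD hx⟩, ?_⟩
  have h := SimpleGraph.rf_greedyTree_le hT hD one_pos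
  rw [rf_one, rf_one] at h
  exact_mod_cast h
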